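/- **Conventions.** Let $G$ be a group. A character is a homomorphism $\chi: G\to(\mathbb R,+)$, and $S(G)$ is the set of classes $[\chi]$ of non-zero characters modulo multiplication by positive reals. Put $G_\chi=\{g\in G\mid \chi(g)\ge 0\}$, a submonoid of $G$; for a subgroup $\widetilde G\le G$ put $\widetilde G_\chi=\widetilde G\cap G_\chi$. Let $m$ be a non-negative integer or $\infty$. An object is of type $FP_m$ if it has a projective resolution $\cdots\to P_1\to P_0$ with $P_i$ finitely generated for all finite $i\le m$. $\Sigma^m(G,\mathbb Z)\subseteq S(G)$ is the set of all $[\chi]$ such that the trivial left module $\mathbb Z$ is of type $FP_m$ over the monoid ring $\mathbb Z G_\chi$. For a cancellative monoid $M$ the orbit category $\mathcal O_{\mathcal F}M$ has as objects the left $M$-sets $M/K$, $K$ a finite subgroup of $M$, and as morphisms the $M$-equivariant maps. A Bredon module over $M$ is a contravariant functor $V$ from $\mathcal O_{\mathcal F}M$ to abelian groups; it is finitely generated if there are finitely many elements $x_j\in V(M/K_j)$ that lie in no proper subfunctor of $V$. The constant Bredon module with value $\mathbb Z$ and identity maps is denoted $\underline{\mathbb Z}$; it is of type $\underline{FP}_m$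 if it is of type $FP_m$ in the abelian category of Bredon modules over $M$. The monoid $M$ conjugates finite subgroups if, whenever $H_1g=gH_2$ for finite subgroups $H_1,H_2$ of $M$ and some $g\in M$, there is an invertible $h\in M$ with $h^{-1}H_1h=H_2$. $\underline\Sigma^m(G,\underline{\mathbb Z})\subseteq S(G)$ is the set of all $[\chi]$ for which there is a subgroup $\widetilde G$ of finite index in $G$, containing the commutator subgroup $G'$ and all finite subgroups of $G$, such that $M=\widetilde G_\chi$ conjugates finite subgroups and $\underline{\mathbb Z}$ is of type $\underline{FP}_m$ over $\mathcal O_{\mathcal F}M$. **Theorem.** Let $G$ be a finitely generated group, $\chi:G\to\mathbb R$ a non-zero character, and $m$ a non-negative integer or $\infty$. Then $[\chi]\in\underline\Sigma^m(G,\underline{\mathbb Z})$ if and only if there are a subgroup $\widetilde G$ of finite index in $G$ with $G'\le\widetilde G$ and a finite family $H_1,\dots,H_s$ of finite subgroups of $\widetilde G$ such that every finite subgroup $K$ of $G$ satisfies $K\le\widetilde G$ and the following three conditions: 1. $N_{\widetilde G}(K)\,(\ker\chi\cap\widetilde G)=\widetilde G$; 2. $\chi(N_G(K))\ne 0$ and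 $[\chi|_{N_G(K)}]\in\Sigma^m(N_G(K),\mathbb Z)$; 3. there are an element $t\in\widetilde G_\chi$ and an index $i\in\{1,\dots,s\}$ with $Kt\subseteq tH_i$. -/

import Mathlib

open CategoryTheory
open scoped Pointwise

universe u v

/-! ### Finiteness types `FP_n` -/

/-- An object `Z` of `C` is of type `FP_n`, with respect to a notion `fg` of finitely generated
object, if it has a projective resolution `⋯ → P₁ → P₀ → Z → 0` with `P_i` finitely generated for
all `i ≤ n`.  For `n = ⊤` this is type `FP_∞`. -/
def HasTypeFP {C : Type u} [Category.{v} C] [Limits.HasZeroObject C] [Limits.HasZeroMorphisms C]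
    (fg : C → Prop) (n : ℕ∞) (Z : C) : Prop :=
  ∃ P : ProjectiveResolution Z, ∀ i : ℕ, (i : ℕ∞) ≤ n → fg (P.complex.X i)

/-- The trivial left module `ℤ` over the monoid ring `ℤM`. -/
noncomputable def trivialMonoidModule (M : Type u) [Monoid M] :
    ModuleCat.{u} (MonoidAlgebra ℤ M) :=
  ModuleCat.of (MonoidAlgebra ℤ M) (Representation.trivial ℤ M (ULift.{u} ℤ)).asModule

/-- A monoid `M` is of type `FP_n` if the trivial left `ℤM`-module `ℤ` is of type `FP_n`. -/
def MonoidTypeFP (n : ℕ∞) (M : Type u) [Monoid M] : Prop :=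
  HasTypeFP (fun A : ModuleCat.{u} (MonoidAlgebra ℤ M) => Module.Finite (MonoidAlgebra ℤ M) A) n
    (trivialMonoidModule M)

/-! ### Finite subgroups of a monoid and the orbit category -/

/-- A finite subgroup of a monoid `M`: a finite submonoid that is a group. -/
structure FiniteSubgroup (M : Type u) [Monoid M] extends Submonoid M where
  finite' : carrier.Finite
  exists_inv' : ∀ x ∈ carrier, ∃ y ∈ carrier, x * y = 1 ∧ y * x = 1

/-- The equivalence relation on `M` whose classes are the cosets `mK`. -/
def FiniteSubgroup.cosetSetoid {M : Type u} [Monoid M] (K : FiniteSubgroup M) : Setoid M where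
  r a b := ∃ k ∈ K.toSubmonoid, a * k = b
  iseqv :=
    { refl := fun a => ⟨1, K.toSubmonoid.one_mem, mul_one a⟩
      symm := by
        rintro a b ⟨k, hk, rfl⟩
        obtain ⟨l, hl, h, -⟩ := K.exists_inv' k hk
        exact ⟨l, hl, by rw [mul_assoc, h, mul_one]⟩
      trans := by
        rintro a b c ⟨k, hk, rfl⟩ ⟨l, hl, rfl⟩
        exact ⟨k * l, K.toSubmonoid.mul_mem hk hl, (mul_assoc a k l).symm⟩ }

/-- The `M`-set `M/K = {mK | m ∈ M}`. -/
def FiniteSubgroup.Cosets {M : Type u} [Monoid M] (K : FiniteSubgroup M) : Type u :=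
  Quotient K.cosetSetoid

/-- The left action of `M` on `M/K`, given by `x • mK = (xm)K`. -/
instance FiniteSubgroup.instSMulCosets {M : Type u} [Monoid M] (K : FiniteSubgroup M) :
    SMul M K.Cosets where
  smul x := Quotient.map (fun m => x * m) (by
    rintro a b ⟨k, hk, rfl⟩
    exact ⟨k, hk, mul_assoc x a k⟩)

instance FiniteSubgroup.instMulActionCosets {M : Type u} [Monoid M] (K : FiniteSubgroup M) :
    MulAction M K.Cosets where
  one_smul := by
    rintro ⟨m⟩
    exact congrArg (Quotient.mk K.cosetSetoid) (one_mul m)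
  mul_smul := by
    rintro x y ⟨m⟩
    exact congrArg (Quotient.mk K.cosetSetoid) (mul_assoc x y m)

/-- The orbit category of a monoid `M` with respect to finite subgroups: its objects are the
`M`-sets `M/K` with `K` a finite subgroup of `M`, its morphisms are the `M`-equivariant maps. -/
structure OrbitCategory (M : Type u) [Monoid M] where
  sub : FiniteSubgroup M

instance OrbitCategory.instCategory (M : Type u) [Monoid M] :
    Category.{u} (OrbitCategory M) where
  Hom K L := K.sub.Cosets →[M] L.sub.Cosets
  id K := MulActionHom.id M
  comp f g := MulActionHom.comp g f

/-- Bredon modules over `M`: contravariant functors from the orbit category to abelian groups. -/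
abbrev BredonModule (M : Type u) [Monoid M] : Type (u + 1) :=
  (OrbitCategory M)ᵒᵖ ⥤ AddCommGrpCat.{u}

/-- A Bredon module `V` is finitely generated if there are finitely many elements
`x_j ∈ V(M/K_j)` which are not contained in any proper Bredon submodule of `V`. -/
def BredonModule.FG {M : Type u} [Monoid M] (V : BredonModule M) : Prop :=
  ∃ (r : ℕ) (K : Fin r → OrbitCategory M) (x : ∀ j, V.obj (Opposite.op (K j))),
    ∀ W : (∀ L : OrbitCategory M, AddSubgroup (V.obj (Opposite.op L))),
      (∀ (L L' : OrbitCategory M) (f : L ⟶ L'), ∀ y ∈ W L', (V.map f.op).hom y ∈ W L) →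
      (∀ j, x j ∈ W (K j)) → ∀ L, W L = ⊤

/-- The constant Bredon module with value `ℤ`, all of whose structure maps are identities. -/
def trivialBredonModule (M : Type u) [Monoid M] : BredonModule M :=
  (Functor.const (OrbitCategory M)ᵒᵖ).obj (AddCommGrpCat.of (ULift.{u} ℤ))

/-- The trivial Bredon module over `M` is of Bredon type `FP_n`. -/
def BredonTypeFP (n : ℕ∞) (M : Type u) [Monoid M] : Prop :=
  HasTypeFP (fun V : BredonModule M => V.FG) n (trivialBredonModule M)

/-- `M` conjugates finite subgroups: if `H₁g = gH₂` for finite subgroups `H₁, H₂` of `M` and some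
`g ∈ M`, then `h⁻¹H₁h = H₂` for some invertible `h ∈ M`. -/
def ConjugatesFiniteSubgroups (M : Type u) [Monoid M] : Prop :=
  ∀ (H₁ H₂ : FiniteSubgroup M) (g : M),
    (fun x => x * g) '' (H₁.toSubmonoid : Set M) = (fun x => g * x) '' (H₂.toSubmonoid : Set M) →
    ∃ h : Mˣ, (fun x => (↑h⁻¹ : M) * x * (h : M)) '' (H₁.toSubmonoid : Set M) =
      (H₂.toSubmonoid : Set M)

/-! ### Characters -/

/-- A real character of `G`, that is a homomorphism from `G` to the additive group `ℝ`. -/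
abbrev RealChar (G : Type u) [Group G] : Type u := G →* Multiplicative ℝ

/-- The restriction of a character to a subgroup. -/
def RealChar.res {G : Type u} [Group G] (χ : RealChar G) (H : Subgroup G) : RealChar H :=
  χ.comp H.subtype

/-- The monoid `G_χ = {g ∈ G | χ(g) ≥ 0}`. -/
def RealChar.monoid {G : Type u} [Group G] (χ : RealChar G) : Submonoid G where
  carrier := {g | 0 ≤ (χ g).toAdd}
  one_mem' := by simp
  mul_mem' := by
    intro a b ha hb
    change 0 ≤ (χ (a * b)).toAdd
    rw [map_mul, toAdd_mul]
    exact add_nonneg ha hb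

/-- Two non-zero characters are equivalent if they differ by a positive real factor. -/
def charSetoid (G : Type u) [Group G] : Setoid {χ : RealChar G // χ ≠ 1} where
  r χ₁ χ₂ := ∃ r : ℝ, 0 < r ∧ ∀ g : G, (χ₁.1 g).toAdd = r * (χ₂.1 g).toAdd
  iseqv :=
    { refl := fun χ => ⟨1, one_pos, fun g => (one_mul _).symm⟩
      symm := by
        rintro χ₁ χ₂ ⟨r, hr, h⟩
        exact ⟨r⁻¹, inv_pos.2 hr, fun g => by rw [h g, inv_mul_cancel_left₀ hr.ne']⟩
      trans := by
        rintro χ₁ χ₂ χ₃ ⟨r, hr, h⟩ ⟨s, hs, h'⟩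
        exact ⟨r * s, mul_pos hr hs, fun g => by rw [h g, h' g, mul_assoc]⟩ }

/-- The character sphere `S(G) = (Hom(G, ℝ) ∖ {0}) / ∼`. -/
def CharSphere (G : Type u) [Group G] : Type u := Quotient (charSetoid G)

/-- The class `[χ] ∈ S(G)` of a non-zero character `χ`. -/
def CharSphere.mk {G : Type u} [Group G] (χ : RealChar G) (hχ : χ ≠ 1) : CharSphere G :=
  Quotient.mk (charSetoid G) ⟨χ, hχ⟩

/-- The invariant `Σⁿ(G, ℤ)`: the set of all classes `[χ]` such that the trivial left module `ℤ`
is of type `FP_n` over `ℤG_χ`. -/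
def SigmaInv (n : ℕ∞) (G : Type u) [Group G] : Set (CharSphere G) :=
  {c | ∃ (χ : RealChar G) (hχ : χ ≠ 1), c = CharSphere.mk χ hχ ∧ MonoidTypeFP n χ.monoid}

/-- The Bredon invariant `Σ̲ⁿ(G, ℤ̲)`: the set of all classes `[χ]` for which there is a
finite-index subgroup `Gt` of `G` containing `G'` and all finite subgroups of `G` such that the
monoid `M = Gt_χ = {g ∈ Gt | χ(g) ≥ 0}` conjugates finite subgroups and the constant Bredon
module `ℤ̲` over `M` is of Bredon type `FP_n`. -/
def BredonSigma (n : ℕ∞) (G : Type u) [Group G] : Set (CharSphere G) :=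
  {c | ∃ (χ : RealChar G) (hχ : χ ≠ 1), c = CharSphere.mk χ hχ ∧
    ∃ Gt : Subgroup G, Gt.FiniteIndex ∧ commutator G ≤ Gt ∧
      (∀ K : Subgroup G, Finite K → K ≤ Gt) ∧
      ConjugatesFiniteSubgroups (χ.res Gt).monoid ∧
      BredonTypeFP n (χ.res Gt).monoid}

/-!
Let `Gt` be a subgroup of finite index that contains `G'` and all finite subgroups, and let `M` be
the monoid `Gt_χ`. The proof rests on the values of Bredon modules over `M`: the value at `M/K` is a
module over the monoid ring of the normalizer `N(K) = {m ∈ M | Km ⊆ mK}`, which is the monoid of the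
restriction of `χ` to the normalizer of `K` in `Gt`.

*Conjugation.* `M` conjugates finite subgroups if and only if `χ` has the same image on `N_{Gt}(K)`
as on `Gt`, that is `N_{Gt}(K) (ker χ ∩ Gt) = Gt`, for all finite `K`
(`RealChar.conjugatesFiniteSubgroups_iff`). This is assumed from here on.

*Bredon type and normalizers.* The value at `M/K` of a free Bredon module of finite rank is the
permutation module on a finite union of sets of morphisms `M/K → M/L`. By assumption, such a
morphism is an element of `N(K)` followed by a morphism given by an element of `ker χ`. The
permutation module is therefore a finite direct sum of modules induced from finite groups, hence of
type `FP_k` for all `k` (`PermModule.fpn_of_orbits`,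
`RealChar.NormalizersSurject.fpn_permModule_homs`). So a resolution of the trivial Bredon module by
finitely generated projectives shows that all monoids `N(K)` are of type `FP_n`
(`BredonTypeFP.normalizer_fpn`). The generators in degree `0` give finitely many `M/H_i` such that
every `M/K` maps to one of them: `Kt ⊆ tH_i` for some `t ∈ M` (`BredonTypeFP.exists_hom`).
Conversely, if there are such `H_i`, then `t` can be moved into `ker χ` by an element of the
normalizer of `K`, so that `K` is conjugate in `M` to a subgroup of some `H_i`, and the orbit
category has finitely many isomorphism classes (`OrbitCategory.exists_finite_representatives`). A Bredon
module with finitely generated values is then finitely generated, and a resolution can be built step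
by step (`bredonTypeFP_of_normalizer`).

*Finite index.* It remains to replace `N_{Gt}(K)` by `N_G(K)`, in which it is normal of finite
index. For a normal subgroup `H` of finite index in a group `Γ` with a character `χ`, types `FP_k`
of `H_χ` and `Γ_χ` are equivalent. From `H_χ` to `Γ_χ` (`RealChar.fpn_of_res`), induction gives type
`FP_k` of the module `ℤ[Γ/H]`, and `ℤ` is a finitely generated module over this noetherian ring. In
the other direction (`RealChar.fpn_res`) the difficulty is that `ℤΓ_χ` need not be finitely
generated over `R₀ = ℤH_χ`. But for `t ∈ H` with `χ(t) > 0` there are free `R₀`-modules `P` of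
finite rank with `t^{c+1} ℤΓ_χ ⊆ P ⊆ t^c ℤΓ_χ`, and as `t` acts trivially on `ℤ`, this is enough to
carry finite generation of the syzygies over (`FPn.descent`).

Throughout, type `FP_n` is handled through the recursive condition `FPn`, which agrees with the
definition by projective resolutions (`moduleCat_hasTypeFP_iff`).
-/

/-! ### Modules of type `FP_k` -/

/-- Type `FP_k` for modules, by recursion on `k`: type `FP_0` means finitely generated, and `A` is
of type `FP_{k+1}` if it is the quotient of a free module of finite rank by a submodule of
type `FP_k`. -/
def FPn (R : Type u) [Ring R] : ℕ → ∀ (A : Type u) [AddCommGroup A] [Module R A], Prop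
  | 0, A, _, _ => Module.Finite R A
  | k + 1, A, _, _ => ∃ (r : ℕ) (f : (Fin r → R) →ₗ[R] A),
      Function.Surjective f ∧ FPn R k (LinearMap.ker f)

namespace FPn

variable {R : Type u} [Ring R] {A B C : Type u} [AddCommGroup A] [Module R A]
  [AddCommGroup B] [Module R B] [AddCommGroup C] [Module R C]

theorem finite {k : ℕ} (h : FPn R k A) : Module.Finite R A := by
  cases k with
  | zero => exact h
  | succ k =>
    obtain ⟨r, f, hf, -⟩ := h
    exact Module.Finite.of_surjective f hf

theorem of_equiv {k : ℕ} (e : A ≃ₗ[R] B) (h : FPn R k A) : FPn R k B := by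
  cases k with
  | zero =>
    have : Module.Finite R A := h
    exact Module.Finite.equiv e
  | succ k =>
    obtain ⟨r, f, hf, hk⟩ := h
    refine ⟨r, e.toLinearMap ∘ₗ f, e.surjective.comp hf, ?_⟩
    rwa [LinearEquiv.ker_comp]

theorem of_free_surjective {k : ℕ} {F : Type u} [AddCommGroup F] [Module R F] [Module.Free R F]
    [Module.Finite R F] (f : F →ₗ[R] A) (hf : Function.Surjective f)
    (hk : FPn R k (LinearMap.ker f)) : FPn R (k + 1) A := by
  let b := (Module.Free.chooseBasis R F).reindex (Fintype.equivFin _)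
  let e := b.equivFun.symm
  refine ⟨_, f ∘ₗ e.toLinearMap, hf.comp e.surjective, ?_⟩
  refine of_equiv (LinearEquiv.ofSubmodule' e (LinearMap.ker f)).symm hk

/-- An extension of modules of type `FP_k` is of type `FP_k` (the horseshoe lemma). -/
theorem extension {k : ℕ} (f : A →ₗ[R] B) (g : B →ₗ[R] C) (hf : Function.Injective f)
    (hfg : Function.Exact f g) (hg : Function.Surjective g) (hA : FPn R k A) (hC : FPn R k C) :
    FPn R k B := by
  induction k generalizing A B C with
  | zero =>
    have : Module.Finite R A := hA
    have : Module.Finite R C := hC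
    exact Module.Finite.of_exact hfg hg
  | succ k ih =>
    obtain ⟨r, p, hp, hkp⟩ := hA
    obtain ⟨q, s, hs, hks⟩ := hC
    obtain ⟨t, ht⟩ := Module.projective_lifting_property g s hg
    have ht' : ∀ y, g (t y) = s y := fun y => LinearMap.congr_fun ht y
    have hfg' : ∀ x, g (f x) = 0 := fun x => (hfg _).2 ⟨x, rfl⟩
    let π : (Fin r → R) × (Fin q → R) →ₗ[R] B := (f ∘ₗ p).coprod t
    refine of_free_surjective π ?_ ?_
    · intro b
      obtain ⟨y, hy⟩ := hs (g b)
      obtain ⟨a, ha⟩ := (hfg (b - t y)).1 (by rw [map_sub, ht', hy, sub_self])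
      obtain ⟨x, rfl⟩ := hp a
      exact ⟨(x, y), by simp [π, ha]⟩
    · let i : LinearMap.ker p →ₗ[R] LinearMap.ker π :=
        (LinearMap.inl R (Fin r → R) (Fin q → R)).restrict (by
          intro x hx
          simp only [LinearMap.mem_ker] at hx ⊢
          simp [π, hx])
      let j : LinearMap.ker π →ₗ[R] LinearMap.ker s :=
        (LinearMap.snd R (Fin r → R) (Fin q → R)).restrict (by
          rintro ⟨x, y⟩ hx
          have := congrArg g (LinearMap.mem_ker.1 hx)
          simpa [π, hfg', ht'] using this)
      refine ih i j ?_ ?_ ?_ hkp hks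
      · intro x y hxy
        have := congrArg (fun z => z.1.1) hxy
        exact Subtype.ext this
      · rintro ⟨⟨x, y⟩, hx⟩
        constructor
        · intro h
          have hy : y = 0 := congrArg Subtype.val h
          subst hy
          refine ⟨⟨x, ?_⟩, rfl⟩
          have := LinearMap.mem_ker.1 hx
          simp only [π, LinearMap.coprod_apply, map_zero, add_zero] at this
          exact hf (by simpa using this)
        · rintro ⟨x', hx'⟩
          rw [← hx']
          rfl
      · rintro ⟨y, hy⟩
        obtain ⟨a, ha⟩ := (hfg (t y)).1 (by rw [ht']; exact hy)
        obtain ⟨x, hx⟩ := hp (-a)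
        exact ⟨⟨(x, y), by simp [π, hx, ha]⟩, rfl⟩

theorem free [Module.Free R A] [Module.Finite R A] (k : ℕ) : FPn R k A := by
  induction k generalizing A with
  | zero => exact ‹Module.Finite R A›
  | succ k ih =>
    refine of_free_surjective LinearMap.id Function.surjective_id ?_
    rw [LinearMap.ker_id]
    exact ih

theorem cokernel {k : ℕ} (g : B →ₗ[R] C) (hg : Function.Surjective g) (hB : FPn R (k + 1) B)
    (hA : FPn R k (LinearMap.ker g)) : FPn R (k + 1) C := by
  obtain ⟨r, p, hp, hkp⟩ := hB
  refine ⟨r, g ∘ₗ p, hg.comp hp, ?_⟩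
  let i : LinearMap.ker p →ₗ[R] LinearMap.ker (g ∘ₗ p) :=
    Submodule.inclusion (LinearMap.ker_le_ker_comp p g)
  let j : LinearMap.ker (g ∘ₗ p) →ₗ[R] LinearMap.ker g := p.restrict (fun x hx => hx)
  refine extension i j (Submodule.inclusion_injective _) ?_ ?_ hkp hA
  · rintro ⟨x, hx⟩
    constructor
    · intro h
      exact ⟨⟨x, congrArg Subtype.val h⟩, rfl⟩
    · rintro ⟨y, hy⟩
      rw [← hy]
      exact Subtype.ext y.2
  · rintro ⟨b, hb⟩
    obtain ⟨x, rfl⟩ := hp b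
    exact ⟨⟨x, hb⟩, rfl⟩

/-- If `B` is of type `FP_k` and its quotient `C` of type `FP_{k+1}`, the kernel is of
type `FP_k`: by Schanuel's lemma, it is stably the same as an extension of `B` by the first syzygy
of `C`. -/
theorem kernel {k : ℕ} (g : B →ₗ[R] C) (hg : Function.Surjective g) (hB : FPn R k B)
    (hC : FPn R (k + 1) C) : FPn R k (LinearMap.ker g) := by
  obtain ⟨r, p, hp, hkp⟩ := hC
  obtain ⟨t, ht⟩ := Module.projective_lifting_property g p hg
  have ht' : ∀ y, g (t y) = p y := fun y => LinearMap.congr_fun ht y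
  let d : B × (Fin r → R) →ₗ[R] C := g.coprod (-p)
  have hd : ∀ x, x ∈ LinearMap.ker d ↔ g x.1 = p x.2 := by
    intro x
    simp [d, ← sub_eq_add_neg, sub_eq_zero]
  have hX : FPn R k (LinearMap.ker d) := by
    let i : LinearMap.ker p →ₗ[R] LinearMap.ker d :=
      (LinearMap.inr R B (Fin r → R)).restrict (fun x hx => by
        rw [hd]
        simpa using hx.symm)
    let j : LinearMap.ker d →ₗ[R] B := LinearMap.fst R B (Fin r → R) ∘ₗ (LinearMap.ker d).subtype
    refine extension i j ?_ ?_ ?_ hkp hB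
    · intro x y hxy
      exact Subtype.ext (congrArg (fun z => z.1.2) hxy)
    · rintro ⟨⟨b, x⟩, hx⟩
      constructor
      · intro h
        have hb : b = 0 := h
        subst hb
        rw [hd, map_zero] at hx
        exact ⟨⟨x, hx.symm⟩, rfl⟩
      · rintro ⟨y, hy⟩
        rw [← hy]
        rfl
    · intro b
      obtain ⟨x, hx⟩ := hp (g b)
      exact ⟨⟨(b, x), (hd _).2 hx.symm⟩, rfl⟩
  let q : LinearMap.ker d →ₗ[R] LinearMap.ker g :=
    ((LinearMap.id : B →ₗ[R] B).coprod (-t)).restrict (fun x hx => by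
      rw [hd] at hx
      simp [hx, ht'])
  have hqv : ∀ x, (q x : B) = x.1.1 - t x.1.2 := fun x => (sub_eq_add_neg _ _).symm
  have hq : Function.Surjective q := by
    rintro ⟨b, hb⟩
    refine ⟨⟨(b, 0), (hd _).2 (by simpa using hb)⟩, Subtype.ext ?_⟩
    simp [hqv]
  cases k with
  | zero =>
    have : Module.Finite R (LinearMap.ker d) := hX
    exact Module.Finite.of_surjective q hq
  | succ k =>
    refine cokernel q hq hX ?_
    let e : (Fin r → R) →ₗ[R] LinearMap.ker q :=
      LinearMap.codRestrict _ (LinearMap.codRestrict _ (t.prod LinearMap.id)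
        (fun x => by rw [hd]; exact ht' x)) (fun x => by
          rw [LinearMap.mem_ker]
          apply Subtype.ext
          rw [hqv]
          exact sub_self _)
    refine of_equiv (LinearEquiv.ofBijective e ⟨?_, ?_⟩) (free k)
    · intro x y hxy
      exact congrArg (fun z => z.1.1.2) hxy
    · rintro ⟨⟨⟨b, x⟩, hx⟩, hbx⟩
      refine ⟨x, Subtype.ext (Subtype.ext (Prod.ext ?_ rfl))⟩
      have := congrArg Subtype.val (LinearMap.mem_ker.1 hbx)
      rw [hqv] at this
      exact (sub_eq_zero.1 this).symm

theorem of_succ {k : ℕ} (h : FPn R (k + 1) A) : FPn R k A := by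
  induction k generalizing A with
  | zero => exact finite h
  | succ k ih =>
    obtain ⟨r, f, hf, hk⟩ := h
    exact ⟨r, f, hf, ih hk⟩

theorem prod {k : ℕ} (hA : FPn R k A) (hB : FPn R k B) : FPn R k (A × B) :=
  extension (LinearMap.inl R A B) (LinearMap.snd R A B) LinearMap.inl_injective
    Function.Exact.inl_snd LinearMap.snd_surjective hA hB

theorem of_prod_left {k : ℕ} (h : FPn R k (A × B)) : FPn R k A := by
  induction k generalizing A B with
  | zero =>
    have : Module.Finite R (A × B) := h
    exact Module.Finite.of_surjective (LinearMap.fst R A B) LinearMap.fst_surjective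
  | succ k ih =>
    refine cokernel (LinearMap.fst R A B) LinearMap.fst_surjective h ?_
    have hB : FPn R k B := ih (of_equiv (LinearEquiv.prodComm R A B) (of_succ h))
    refine of_equiv ?_ hB
    exact (LinearEquiv.ofInjective (LinearMap.inr R A B) LinearMap.inr_injective).trans
      (LinearEquiv.ofEq _ _ (LinearMap.range_inr R A B))

theorem of_retract {k : ℕ} (i : A →ₗ[R] B) (p : B →ₗ[R] A) (h : p ∘ₗ i = LinearMap.id)
    (hB : FPn R k B) : FPn R k A := by
  have hs : ∀ x, p (i x) = x := fun x => LinearMap.congr_fun h x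
  let e : B ≃ₗ[R] A × LinearMap.ker p := LinearEquiv.ofLinearMap
    (p.prod (LinearMap.codRestrict _ (LinearMap.id - i ∘ₗ p) (fun x => by simp [hs])))
    (i.coprod (LinearMap.ker p).subtype)
    (by
      apply LinearMap.ext
      rintro ⟨a, b, hb⟩
      have hb' : p b = 0 := hb
      refine Prod.ext ?_ (Subtype.ext ?_) <;> simp [hs, hb'])
    (by ext x; simp)
  exact of_prod_left (of_equiv e hB)

theorem projective [Module.Projective R A] [Module.Finite R A] (k : ℕ) : FPn R k A := by
  obtain ⟨n, f, hf⟩ := Module.Finite.exists_fin' R A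
  obtain ⟨g, hg⟩ := Module.projective_lifting_property f LinearMap.id hf
  exact of_retract g f hg (free k)

theorem of_isNoetherianRing [IsNoetherianRing R] [Module.Finite R A] (k : ℕ) : FPn R k A := by
  induction k generalizing A with
  | zero => exact ‹Module.Finite R A›
  | succ k ih =>
    obtain ⟨n, f, hf⟩ := Module.Finite.exists_fin' R A
    exact ⟨n, f, hf, ih⟩

/-- A module resolved by modules `Q i` of type `FP_{k-i}` is of type `FP_k`. -/
theorem of_resolution {k : ℕ} (Q : ℕ → Type u) [∀ i, AddCommGroup (Q i)] [∀ i, Module R (Q i)]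
    (d : ∀ i, Q (i + 1) →ₗ[R] Q i) (ε : Q 0 →ₗ[R] A) (hε : Function.Surjective ε)
    (h0 : Function.Exact (d 0) ε) (hd : ∀ i, Function.Exact (d (i + 1)) (d i))
    (hQ : ∀ i ≤ k, FPn R (k - i) (Q i)) : FPn R k A := by
  induction k generalizing A Q with
  | zero =>
    have : Module.Finite R (Q 0) := hQ 0 le_rfl
    exact Module.Finite.of_surjective ε hε
  | succ k ih =>
    refine cokernel ε hε (hQ 0 (Nat.zero_le _)) ?_
    refine ih (fun i => Q (i + 1)) (fun i => d (i + 1))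
      (LinearMap.codRestrict (LinearMap.ker ε) (d 0) fun x => (h0 _).2 ⟨x, rfl⟩) ?_ ?_ ?_ ?_
    · rintro ⟨x, hx⟩
      obtain ⟨y, rfl⟩ := (h0 x).1 hx
      exact ⟨y, rfl⟩
    · intro x
      rw [← hd 0 x]
      exact ⟨fun h => congrArg Subtype.val h, fun h => Subtype.ext h⟩
    · exact fun i => hd (i + 1)
    · intro i hi
      have := hQ (i + 1) (by omega)
      rwa [Nat.add_sub_add_right] at this

end FPn

/-! ### Change of rings -/

namespace FPn

theorem pi {R : Type u} [Ring R] {D : Type u} [AddCommGroup D] [Module R D] {k : ℕ}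
    (h : FPn R k D) (r : ℕ) : FPn R k (Fin r → D) := by
  induction r with
  | zero => exact free k
  | succ r ih => exact of_equiv (Fin.consLinearEquiv R (fun _ => D)) (prod h ih)

/-- If `R ⧸ J` is noetherian and of type `FP_k` over `R`, so is every finitely generated
`R ⧸ J`-module. -/
theorem of_isNoetherian_quotient {R : Type u} [Ring R] (J : Ideal R) [J.IsTwoSided]
    [IsNoetherian R (R ⧸ J)] {k : ℕ} (hJ : FPn R k (R ⧸ J)) {A : Type u} [AddCommGroup A]
    [Module R A] [Module.Finite R A] (hA : ∀ j ∈ J, ∀ a : A, j • a = 0) : FPn R k A := by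
  induction k generalizing A with
  | zero => exact ‹Module.Finite R A›
  | succ k ih =>
    obtain ⟨r, π, hπ⟩ := Module.Finite.exists_fin' R A
    let l (i : Fin r) : (R ⧸ J) →ₗ[R] A :=
      Submodule.liftQ J (LinearMap.toSpanSingleton R A (π (Pi.single i 1)))
        (fun j hj => hA j hj _)
    let g : (Fin r → R ⧸ J) →ₗ[R] A := ∑ i, (l i).comp (LinearMap.proj i)
    have hg : Function.Surjective g := by
      intro a
      obtain ⟨x, rfl⟩ := hπ a
      refine ⟨fun i => Submodule.Quotient.mk (x i), ?_⟩
      conv_rhs => rw [pi_eq_sum_univ' x, map_sum]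
      simp only [g, l, LinearMap.sum_apply, LinearMap.comp_apply, LinearMap.proj_apply]
      refine Finset.sum_congr rfl fun i _ => ?_
      rw [map_smul]
      erw [Submodule.liftQ_apply]
      rfl
    refine cokernel g hg (pi hJ r) (ih (of_succ hJ) ?_)
    rintro j hj ⟨x, hx⟩
    refine Subtype.ext (funext fun i => ?_)
    change j • x i = 0
    obtain ⟨y, hy⟩ := Submodule.Quotient.mk_surjective J (x i)
    rw [← hy, ← Submodule.Quotient.mk_smul, Submodule.Quotient.mk_eq_zero]
    exact J.mul_mem_right y hj

section BaseChange

variable {S R : Type u} [Ring S] [Ring R]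

/-- An equational form of flatness of `R` as a right `S`-module along `f : S → R`: finitely many
elements of `R` always lie in the right `S`-span of finitely many right `S`-independent ones. -/
def _root_.RingHom.LocallyFree (f : S →+* R) : Prop :=
  ∀ (s : ℕ) (x : Fin s → R), ∃ (ι : Type u) (_ : Fintype ι) (c : ι → R) (y : ι → Fin s → S),
    (∀ i, x i = ∑ j, c j * f (y j i)) ∧ ∀ z : ι → S, ∑ j, c j * f (z j) = 0 → z = 0

/-- The `R`-submodule of `R^r` generated by the image of an `S`-submodule of `S^r`. -/
def extendSubmodule (f : S →+* R) {r : ℕ} (Y : Submodule S (Fin r → S)) :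
    Submodule R (Fin r → R) :=
  Submodule.span R ((fun y i => f (y i)) '' (Y : Set (Fin r → S)))

theorem map_apply_of_compat (f : S →+* R) {s r : ℕ} (g : (Fin s → S) →ₗ[S] (Fin r → S))
    (x : Fin s → S) (k : Fin r) :
    Fintype.linearCombination R (fun i k => f (g (Pi.single i 1) k)) (fun i => f (x i)) k =
      f (g x k) := by
  rw [Fintype.linearCombination_apply, Finset.sum_apply]
  conv_rhs => rw [pi_eq_sum_univ' x, map_sum, Finset.sum_apply, map_sum]
  refine Finset.sum_congr rfl fun i _ => ?_
  rw [map_smul, Pi.smul_apply, Pi.smul_apply, smul_eq_mul, smul_eq_mul, map_mul]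

/-- A matrix over `S` has the same kernel over `R`, up to extension of scalars. -/
theorem ker_linearCombination {f : S →+* R} (hf : f.LocallyFree) {s r : ℕ}
    (g : (Fin s → S) →ₗ[S] (Fin r → S)) :
    LinearMap.ker (Fintype.linearCombination R (fun i k => f (g (Pi.single i 1) k))) =
      extendSubmodule f (LinearMap.ker g) := by
  apply le_antisymm
  · intro x hx
    obtain ⟨ι, _, c, y, hxy, hc⟩ := hf s x
    have hx' : x = ∑ j, c j • (fun i => f (y j i)) := by
      funext i
      rw [hxy i, Finset.sum_apply]
      rfl
    have hy : ∀ j, y j ∈ LinearMap.ker g := by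
      intro j
      rw [LinearMap.mem_ker]
      funext k
      have h0 := congrFun (LinearMap.mem_ker.1 hx) k
      rw [hx', map_sum, Finset.sum_apply] at h0
      refine congrFun (hc (fun j => g (y j) k) ?_) j
      rw [← Pi.zero_apply (M := fun _ => R) k, ← h0]
      refine Finset.sum_congr rfl fun j _ => ?_
      rw [map_smul, Pi.smul_apply, map_apply_of_compat, smul_eq_mul]
    rw [hx']
    exact Submodule.sum_mem _ fun j _ => Submodule.smul_mem _ _
      (Submodule.subset_span ⟨y j, hy j, rfl⟩)
  · rw [extendSubmodule, Submodule.span_le]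
    rintro _ ⟨y, hy, rfl⟩
    rw [SetLike.mem_coe, LinearMap.mem_ker]
    funext k
    rw [map_apply_of_compat, LinearMap.mem_ker.1 hy]
    simp

theorem extendScalars {f : S →+* R} (hf : f.LocallyFree) {k r : ℕ}
    (Y : Submodule S (Fin r → S)) (h : FPn S k ((Fin r → S) ⧸ Y)) :
    FPn R k ((Fin r → R) ⧸ extendSubmodule f Y) := by
  induction k generalizing r with
  | zero => exact Module.Finite.quotient R _
  | succ k ih =>
    have hY : FPn S k Y := by
      refine of_equiv (LinearEquiv.ofEq _ _ Y.ker_mkQ) ?_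
      exact kernel Y.mkQ Y.mkQ_surjective (free k) h
    have := hY.finite
    obtain ⟨s, g, hg⟩ := Module.Finite.exists_fin' S Y
    let G := Fintype.linearCombination R (fun i k => f ((Y.subtype ∘ₗ g) (Pi.single i 1) k))
    have hG : LinearMap.range G = extendSubmodule f Y := by
      apply le_antisymm
      · rintro _ ⟨x, rfl⟩
        rw [Fintype.linearCombination_apply]
        exact Submodule.sum_mem _ fun i _ => Submodule.smul_mem _ _
          (Submodule.subset_span ⟨_, (g (Pi.single i 1)).2, rfl⟩)
      · rw [extendSubmodule, Submodule.span_le]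
        rintro _ ⟨y, hy, rfl⟩
        obtain ⟨x, hx⟩ := hg ⟨y, hy⟩
        refine ⟨fun i => f (x i), ?_⟩
        funext k
        rw [map_apply_of_compat]
        simp [hx]
    have h1 : FPn S k ((Fin s → S) ⧸ LinearMap.ker (Y.subtype ∘ₗ g)) := by
      refine of_equiv ?_ hY
      refine (LinearMap.quotKerEquivOfSurjective g hg).symm.trans
        (Submodule.quotEquivOfEq _ _ ?_)
      rw [LinearMap.ker_comp, Submodule.ker_subtype, Submodule.comap_bot]
    have h2 := ih _ h1
    rw [← ker_linearCombination hf] at h2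
    refine cokernel (Submodule.mkQ _) (Submodule.mkQ_surjective _) (free (k + 1)) ?_
    rw [Submodule.ker_mkQ, ← hG]
    exact of_equiv (LinearMap.quotKerEquivRange G) h2

/-- Extension of scalars for cyclic modules: if `A = S a` is of type `FP_k` and the annihilator of
the generator `b` of `B` is generated by the image of the annihilator of `a`, then `B ≅ R ⊗_S A` is
of type `FP_k`. -/
theorem extendScalars_cyclic {f : S →+* R} (hf : f.LocallyFree) {k : ℕ} {A B : Type u}
    [AddCommGroup A] [Module S A] [AddCommGroup B] [Module R B] (a : A) (b : B)
    (ha : ∀ x : A, ∃ s : S, s • a = x) (hb : ∀ x : B, ∃ r : R, r • b = x)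
    (h1 : ∀ s : S, s • a = 0 → f s • b = 0)
    (h2 : ∀ r : R, r • b = 0 → r ∈ Submodule.span R (f '' {s | s • a = 0}))
    (h : FPn S k A) : FPn R k B := by
  let α : (Fin 1 → S) →ₗ[S] A := LinearMap.toSpanSingleton S A a ∘ₗ LinearMap.proj 0
  let β : (Fin 1 → R) →ₗ[R] B := LinearMap.toSpanSingleton R B b ∘ₗ LinearMap.proj 0
  have hα : Function.Surjective α := fun x => by
    obtain ⟨s, rfl⟩ := ha x
    exact ⟨fun _ => s, rfl⟩
  have hβ : Function.Surjective β := fun x => by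
    obtain ⟨s, rfl⟩ := hb x
    exact ⟨fun _ => s, rfl⟩
  have h3 : extendSubmodule f (LinearMap.ker α) = LinearMap.ker β := by
    apply le_antisymm
    · rw [extendSubmodule, Submodule.span_le]
      rintro _ ⟨y, hy, rfl⟩
      exact h1 _ hy
    · intro x hx
      have hx' := h2 (x 0) hx
      have : x = LinearMap.pi (fun _ : Fin 1 => (LinearMap.id : R →ₗ[R] R)) (x 0) := by
        funext i
        rw [Subsingleton.elim i 0]
        rfl
      rw [this]
      refine Submodule.span_induction (p := fun z _ => LinearMap.pi
        (fun _ : Fin 1 => (LinearMap.id : R →ₗ[R] R)) z ∈ extendSubmodule f (LinearMap.ker α))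
        ?_ ?_ ?_ ?_ hx'
      · rintro _ ⟨s, hs, rfl⟩
        exact Submodule.subset_span ⟨fun _ => s, hs, rfl⟩
      · rw [map_zero]
        exact Submodule.zero_mem _
      · intro y z _ _ hy hz
        rw [map_add]
        exact Submodule.add_mem _ hy hz
      · intro c y _ hy
        rw [map_smul]
        exact Submodule.smul_mem _ _ hy
  have h4 := extendScalars hf (LinearMap.ker α)
    (of_equiv (LinearMap.quotKerEquivOfSurjective α hα).symm h)
  rw [h3] at h4
  exact of_equiv (LinearMap.quotKerEquivOfSurjective β hβ) h4

end BaseChange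

end FPn

/-! ### Restriction of scalars along a normalizing element -/

section Descent

variable {S R : Type u} [Ring S] [Ring R] [Module S R]

/-- The set `t^c A`, as a submodule over a subring `S` of `R` which is normalized by `t`. -/
def powSMul [IsScalarTower S R R] (t : R) (ht : ∀ s : S, ∃ s' : S, s • t = t * (s' • (1 : R)))
    (A : Type u) [AddCommGroup A]
    [Module R A] [Module S A] [IsScalarTower S R A] (c : ℕ) : Submodule S A where
  carrier := {x | ∃ a : A, x = t ^ c • a}
  zero_mem' := ⟨0, (smul_zero _).symm⟩
  add_mem' := by
    rintro _ _ ⟨a, rfl⟩ ⟨b, rfl⟩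
    exact ⟨a + b, (smul_add _ _ _).symm⟩
  smul_mem' := by
    have h : ∀ (c : ℕ) (s : S), ∃ s' : S, s • t ^ c = t ^ c * (s' • (1 : R)) := by
      intro c
      induction c with
      | zero => exact fun s => ⟨s, by rw [pow_zero, one_mul]⟩
      | succ c ih =>
        intro s
        obtain ⟨s₁, h₁⟩ := ih s
        obtain ⟨s₂, h₂⟩ := ht s₁
        refine ⟨s₂, ?_⟩
        rw [pow_succ, ← smul_mul_assoc, h₁, mul_assoc, smul_mul_assoc, one_mul, h₂, mul_assoc]
    rintro s _ ⟨a, rfl⟩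
    obtain ⟨s', hs'⟩ := h c s
    exact ⟨(s' • (1 : R)) • a, by rw [← smul_assoc, hs', mul_smul]⟩

variable [IsScalarTower S R R] {t : R} {ht : ∀ s : S, ∃ s' : S, s • t = t * (s' • (1 : R))}

theorem powSMul_mem {A : Type u} [AddCommGroup A]
    [Module R A] [Module S A] [IsScalarTower S R A] (c : ℕ) (a : A) :
    t ^ c • a ∈ powSMul t ht A c :=
  ⟨a, rfl⟩

theorem powSMul_le {A : Type u} [AddCommGroup A]
    [Module R A] [Module S A] [IsScalarTower S R A] {c d : ℕ} (h : c ≤ d) :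
    powSMul t ht A d ≤ powSMul t ht A c := by
  rintro _ ⟨a, rfl⟩
  refine ⟨t ^ (d - c) • a, ?_⟩
  rw [← mul_smul, ← pow_add, Nat.add_sub_cancel' h]

namespace FPn

theorem powSMul_pi {r : ℕ} {c : ℕ} {y : Fin r → R} (hy : y ∈ powSMul t ht (Fin r → R) c)
    (i : Fin r) : y i ∈ powSMul t ht R c := by
  obtain ⟨z, rfl⟩ := hy
  exact ⟨z i, rfl⟩

/-- The map `P^r → t^c A` induced by `π : R^r → A`, for `P ⊆ t^c R`. -/
def coverMap {A : Type u} [AddCommGroup A] [Module R A] [Module S A] [IsScalarTower S R A]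
    {r c : ℕ} (π : (Fin r → R) →ₗ[R] A) (P : Submodule S R) (hP : P ≤ powSMul t ht R c) :
    (Fin r → P) →ₗ[S] powSMul t ht A c :=
  LinearMap.codRestrict _
    (π.restrictScalars S ∘ₗ LinearMap.pi fun i => P.subtype ∘ₗ LinearMap.proj i) (by
      intro x
      choose z hz using fun i => hP (x i).2
      refine ⟨π z, ?_⟩
      rw [← map_smul]
      exact congrArg π (funext hz))

theorem coverMap_coe {A : Type u} [AddCommGroup A] [Module R A] [Module S A] [IsScalarTower S R A]
    {r c : ℕ} (π : (Fin r → R) →ₗ[R] A) (P : Submodule S R) (hP : P ≤ powSMul t ht R c)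
    (x : Fin r → P) : (coverMap π P hP x : A) = π (fun i => (x i : R)) :=
  rfl

/-- The inductive heart of the descent of type `FP_n` from `R` to `S`. The free `R`-modules `R^r`
are not finitely generated over `S`, but `t^{c+1} R^r ⊆ P^r ⊆ t^c R^r` with `P^r` free of finite
rank over `S`. An `S`-module `B` which is a retract of the inclusion
`t^{c+n+1} A ⊆ t^c A`, up to an endomorphism that factors through a free module `Q` of finite rank,
is then of type `FP_n`: in each degree one factor `t` is spent on passing
through `P^r`. -/
theorem descent_aux (htR : ∀ x : R, t * x = 0 → x = 0)
    (hP : ∀ c : ℕ, ∃ P : Submodule S R, Module.Free S P ∧ Module.Finite S P ∧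
      P ≤ powSMul t ht R c ∧ powSMul t ht R (c + 1) ≤ P) (n : ℕ) :
    ∀ (A : Type u) [AddCommGroup A] [Module R A] [Module S A] [IsScalarTower S R A]
      (_ : FPn R n A) (_ : ∀ a : A, t • a = 0 → a = 0) (c : ℕ)
      (B : Type u) [AddCommGroup B] [Module S B] (α : B →ₗ[S] A)
      (hα : ∀ b, α b ∈ powSMul t ht A (c + n + 1)) (β : powSMul t ht A c →ₗ[S] B)
      (Q : Type u) [AddCommGroup Q] [Module S Q] [Module.Free S Q] [Module.Finite S Q]
      (p : B →ₗ[S] Q) (q : Q →ₗ[S] B)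
      (_ : ∀ b, β ⟨α b, powSMul_le (by omega) (hα b)⟩ = b + q (p b)), FPn S n B := by
  have hfin : ∀ e : ℕ, Module.Finite S (Fin e → S) := fun e => inferInstance
  have key : ∀ (n : ℕ) (A : Type u) [AddCommGroup A] [Module R A] [Module S A]
      [IsScalarTower S R A] (_ : Module.Finite R A) (c : ℕ)
      (B : Type u) [AddCommGroup B] [Module S B] (α : B →ₗ[S] A)
      (hα : ∀ b, α b ∈ powSMul t ht A (c + n + 1)) (β : powSMul t ht A c →ₗ[S] B)
      (Q : Type u) [AddCommGroup Q] [Module S Q] [Module.Free S Q] [Module.Finite S Q]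
      (p : B →ₗ[S] Q) (q : Q →ₗ[S] B)
      (_ : ∀ b, β ⟨α b, powSMul_le (by omega) (hα b)⟩ = b + q (p b)), Module.Finite S B := by
    intro n A _ _ _ _ hA c B _ _ α hα β Q _ _ _ _ p q hβ
    obtain ⟨r, π, hπ⟩ := Module.Finite.exists_fin' R A
    obtain ⟨P, hPf, hPfin, hP1, hP2⟩ := hP c
    -- As `b = βα(b) - qp(b)` and `α(b) ∈ t^{c+1} A` comes from `P^r`, the module `B` is generated
    -- by the images of `P^r` and `Q`.
    refine Module.Finite.of_surjective ((β ∘ₗ coverMap π P hP1).coprod (-q)) ?_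
    intro b
    obtain ⟨a, ha⟩ := powSMul_le (show c + 1 ≤ c + n + 1 by omega) (hα b)
    obtain ⟨y, rfl⟩ := hπ a
    refine ⟨(fun i => ⟨t ^ (c + 1) • y i, hP2 (powSMul_mem (c + 1) (y i))⟩, p b), ?_⟩
    have h1 : coverMap π P hP1 (fun i => ⟨t ^ (c + 1) • y i, hP2 (powSMul_mem (c + 1) (y i))⟩) =
        ⟨α b, powSMul_le (by omega) (hα b)⟩ := by
      apply Subtype.ext
      rw [coverMap_coe]
      change _ = α b
      rw [ha, ← map_smul]
      rfl
    rw [LinearMap.coprod_apply, LinearMap.comp_apply]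
    dsimp only
    rw [h1, hβ]
    simp
  induction n with
  | zero =>
    intro A _ _ _ _ hA htA c B _ _ α hα β Q _ _ _ _ p q hβ
    exact key 0 A hA c B α hα β Q p q hβ
  | succ n ih =>
    intro A _ _ _ _ hA htA c B _ _ α hα β Q _ _ _ _ p q hβ
    have hB := key (n + 1) A hA.finite c B α hα β Q p q hβ
    obtain ⟨r, π, hπ, hK⟩ := hA
    obtain ⟨P, hPf, hPfin, hP1, hP2⟩ := hP c
    obtain ⟨e, g, hg⟩ := Module.Finite.exists_fin' S B
    have hfree : Module.Free S (Fin e → S) := Module.Free.function _ _ _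
    have hfin := hfin e
    refine ⟨e, g, hg, ?_⟩
    -- The lift `α'` of `α` to free covers; it takes values in the same power of `t` as `α`.
    have hlift : ∀ b : B, ∃ y : Fin r → R, y ∈ powSMul t ht (Fin r → R) (c + (n + 1) + 1) ∧
        π y = α b := by
      intro b
      obtain ⟨a, ha⟩ := hα b
      obtain ⟨z, rfl⟩ := hπ a
      exact ⟨t ^ (c + (n + 1) + 1) • z, powSMul_mem _ z, by rw [map_smul, ha]⟩
    choose y hy hπy using hlift
    let α' : (Fin e → S) →ₗ[S] (Fin r → R) :=
      Fintype.linearCombination S (fun i => y (g (Pi.single i 1)))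
    have hα' : ∀ x, α' x ∈ powSMul t ht (Fin r → R) (c + (n + 1) + 1) := by
      intro x
      rw [Fintype.linearCombination_apply]
      exact Submodule.sum_mem _ fun i _ => Submodule.smul_mem _ _ (hy _)
    have hπα : ∀ x, π (α' x) = α (g x) := by
      have : π.restrictScalars S ∘ₗ α' = α ∘ₗ g := by
        refine LinearMap.pi_ext' fun i => LinearMap.ext_ring ?_
        simp [α', Fintype.linearCombination_apply_single, hπy]
      exact fun x => LinearMap.congr_fun this x
    -- The lift `β'` of `β` to free covers, which is defined on `P^r ⊇ t^{c+1} R^r` only.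
    obtain ⟨β', hβ'⟩ := Module.projective_lifting_property g (β ∘ₗ coverMap π P hP1) hg
    have hβ'' : ∀ x, g (β' x) = β (coverMap π P hP1 x) := fun x => LinearMap.congr_fun hβ' x
    obtain ⟨q', hq'⟩ := Module.projective_lifting_property g q hg
    have hq'' : ∀ x, g (q' x) = q x := fun x => LinearMap.congr_fun hq' x
    -- `j` regards an element of `t^{c+1} R^r` as an element of `P^r`.
    let j : powSMul t ht (Fin r → R) (c + 1) →ₗ[S] (Fin r → P) :=
      LinearMap.pi fun i => LinearMap.codRestrict P
        (LinearMap.proj i ∘ₗ Submodule.subtype _) (fun x => hP2 (powSMul_pi x.2 i))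
    have hj : ∀ x, (coverMap π P hP1 (j x) : A) = π x.1 := fun x => rfl
    let α'' : (Fin e → S) →ₗ[S] powSMul t ht (Fin r → R) (c + 1) :=
      LinearMap.codRestrict _ α' (fun x => powSMul_le (by omega) (hα' x))
    let i : LinearMap.ker π →ₗ[S] (Fin r → R) := (Submodule.subtype _).restrictScalars S
    have hi : ∀ x : powSMul t ht (LinearMap.ker π) (c + 1),
        i x.1 ∈ powSMul t ht (Fin r → R) (c + 1) := by
      rintro ⟨_, z, rfl⟩
      exact ⟨z.1, rfl⟩
    let i' : powSMul t ht (LinearMap.ker π) (c + 1) →ₗ[S] powSMul t ht (Fin r → R) (c + 1) :=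
      LinearMap.codRestrict _ (i ∘ₗ Submodule.subtype _) hi
    have hpow : ∀ (k : ℕ) (a : A), t ^ k • a = 0 → a = 0 := by
      intro k
      induction k with
      | zero => exact fun a ha => by rwa [pow_zero, one_smul] at ha
      | succ k ihk =>
        intro a ha
        rw [pow_succ', mul_smul] at ha
        exact ihk a (htA _ ha)
    -- The kernels of the covers `g` and `π` are again in the situation of the lemma, with `c + 1`
    -- for `c`. As `t` is injective on `A`, lifting `α` to `αK` loses no power of `t`.
    let αK : LinearMap.ker g →ₗ[S] LinearMap.ker π :=
      { toFun x := ⟨α' x.1, by rw [LinearMap.mem_ker, hπα, LinearMap.mem_ker.1 x.2, map_zero]⟩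
        map_add' x y := Subtype.ext (map_add α' x.1 y.1)
        map_smul' s x := Subtype.ext (map_smul α' s x.1) }
    have hαK : ∀ x, αK x ∈ powSMul t ht (LinearMap.ker π) (c + 1 + n + 1) := by
      intro x
      obtain ⟨z, hz⟩ := hα' x.1
      have hzk : π z = 0 := by
        refine hpow (c + (n + 1) + 1) _ ?_
        rw [← map_smul, ← hz, hπα, LinearMap.mem_ker.1 x.2, map_zero]
      refine ⟨⟨z, hzk⟩, Subtype.ext ?_⟩
      rw [show c + 1 + n + 1 = c + (n + 1) + 1 by omega]
      exact hz
    let βK : powSMul t ht (LinearMap.ker π) (c + 1) →ₗ[S] LinearMap.ker g :=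
      LinearMap.codRestrict _ (β' ∘ₗ j ∘ₗ i') (fun x => by
        have h0 : coverMap π P hP1 (j (i' x)) = 0 := Subtype.ext (x.1.2)
        rw [LinearMap.mem_ker, LinearMap.comp_apply, LinearMap.comp_apply, hβ'', h0, map_zero])
    -- On `S^e` the lift of `βα` agrees with the identity plus a map through `Q`, modulo `ker g`.
    let qK : (Fin e → S) →ₗ[S] LinearMap.ker g :=
      LinearMap.codRestrict _ (β' ∘ₗ j ∘ₗ α'' - LinearMap.id - q' ∘ₗ p ∘ₗ g) (fun x => by
        have h0 : coverMap π P hP1 (j (α'' x)) = ⟨α (g x), powSMul_le (by omega) (hα (g x))⟩ :=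
          Subtype.ext (hπα x)
        simp only [LinearMap.mem_ker, LinearMap.sub_apply, LinearMap.comp_apply, map_sub, hβ'',
          hq'', h0, hβ, LinearMap.id_apply]
        abel)
    refine ih (LinearMap.ker π) hK (fun a ha => Subtype.ext (funext fun i =>
      htR _ (congrFun (congrArg Subtype.val ha) i))) (c + 1)
      (LinearMap.ker g) αK hαK βK (Fin e → S) (LinearMap.ker g).subtype qK ?_
    intro x
    apply Subtype.ext
    change β' (j (α'' x.1)) = x.1 + (β' (j (α'' x.1)) - x.1 - q' (p (g x.1)))
    rw [LinearMap.mem_ker.1 x.2, map_zero, map_zero]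
    abel

/-- Type `FP_n` descends from `R` to `S` for modules on which `t` acts trivially. -/
theorem descent (htR : ∀ x : R, t * x = 0 → x = 0)
    (hP : ∀ c : ℕ, ∃ P : Submodule S R, Module.Free S P ∧ Module.Finite S P ∧
      P ≤ powSMul t ht R c ∧ powSMul t ht R (c + 1) ≤ P) {n : ℕ}
    {A : Type u} [AddCommGroup A] [Module R A] [Module S A] [IsScalarTower S R A]
    (hA : FPn R n A) (h0 : ∀ a : A, t • a = a) : FPn S n A := by
  refine descent_aux htR hP n A hA (fun a ha => by rwa [h0] at ha) 0 A LinearMap.id (fun a => ?_)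
    (Submodule.subtype _) PUnit 0 0 (fun b => by simp)
  refine ⟨a, ?_⟩
  have : ∀ k : ℕ, t ^ k • a = a := by
    intro k
    induction k with
    | zero => rw [pow_zero, one_smul]
    | succ k ih => rw [pow_succ, mul_smul, h0, ih]
  exact (this _).symm

end FPn

end Descent

/-! ### Projective resolutions -/

section Resolution

open Limits

theorem exact_epi_kernel {C : Type u} [Category.{v} C] [Abelian C] {P Q V W : C}
    (f : Q ⟶ V) (p : P ⟶ kernel f) [Epi p] (i : V ⟶ W) [Mono i]
    (h : (p ≫ kernel.ι f) ≫ f ≫ i = 0) :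
    (ShortComplex.mk (p ≫ kernel.ι f) (f ≫ i) h).Exact := by
  have h1 : (ShortComplex.mk (kernel.ι f) f (kernel.condition f)).Exact :=
    ShortComplex.exact_kernel f
  have h2 : (ShortComplex.mk (p ≫ kernel.ι f) f (by simp)).Exact := by
    let φ : ShortComplex.mk (p ≫ kernel.ι f) f (by simp) ⟶
        ShortComplex.mk (kernel.ι f) f (kernel.condition f) :=
      { τ₁ := p, τ₂ := 𝟙 _, τ₃ := 𝟙 _ }
    have : Epi φ.τ₁ := ‹Epi p›
    have : IsIso φ.τ₂ := inferInstanceAs (IsIso (𝟙 _))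
    have : Mono φ.τ₃ := inferInstanceAs (Mono (𝟙 _))
    exact (ShortComplex.exact_iff_of_epi_of_isIso_of_mono φ).2 h1
  let φ : ShortComplex.mk (p ≫ kernel.ι f) f (by simp) ⟶
      ShortComplex.mk (p ≫ kernel.ι f) (f ≫ i) h :=
    { τ₁ := 𝟙 _, τ₂ := 𝟙 _, τ₃ := i }
  have : Epi φ.τ₁ := inferInstanceAs (Epi (𝟙 _))
  have : IsIso φ.τ₂ := inferInstanceAs (IsIso (𝟙 _))
  have : Mono φ.τ₃ := ‹Mono i›
  exact (ShortComplex.exact_iff_of_epi_of_isIso_of_mono φ).1 h2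

/-- A projective resolution is built one step at a time: it suffices to have a property `Ψ k` of
objects, to be satisfied by the `k`-th syzygy, and to find the next term of the resolution for every
object with this property. -/
theorem hasTypeFP_of_step {C : Type u} [Category.{v} C] [Abelian C] (fg : C → Prop) (n : ℕ∞)
    (Ψ : ℕ → C → Prop)
    (step : ∀ k V, Ψ k V → ∃ (P : C) (_ : Projective P) (f : P ⟶ V), Epi f ∧
      ((k : ℕ∞) ≤ n → fg P) ∧ Ψ (k + 1) (kernel f))
    (V : C) (h : Ψ 0 V) : HasTypeFP fg n V := by
  choose P hP f hf hfg hΨ using step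
  -- `B k` is the `k`-th syzygy, `X k` its projective cover by `p k`, and `ι k` the inclusion of the
  -- next syzygy.
  let B : ∀ k : ℕ, {V : C // Ψ k V} := fun k =>
    Nat.rec ⟨V, h⟩ (fun k b => ⟨kernel (f k b.1 b.2), hΨ k b.1 b.2⟩) k
  let X : ℕ → C := fun k => P k (B k).1 (B k).2
  let p : ∀ k, X k ⟶ (B k).1 := fun k => f k (B k).1 (B k).2
  have hp : ∀ k, Epi (p k) := fun k => hf k (B k).1 (B k).2
  let ι : ∀ k, (B (k + 1)).1 ⟶ X k := fun k => kernel.ι (p k)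
  have hι : ∀ k, Mono (ι k) := fun k => inferInstanceAs (Mono (kernel.ι (p k)))
  have hpι : ∀ k, ι k ≫ p k = 0 := fun k => kernel.condition (p k)
  let d : ∀ k, X (k + 1) ⟶ X k := fun k => p (k + 1) ≫ ι k
  have hd : ∀ k, d (k + 1) ≫ d k = 0 := fun k => by
    simp only [d, Category.assoc]
    rw [reassoc_of% hpι, zero_comp, comp_zero]
  let K := ChainComplex.of X d hd
  have hKd : ∀ k, K.d (k + 1) k = d k := fun k => ChainComplex.of_d X d k
  have hK : ∀ k, K.ExactAt (k + 1) := by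
    intro k
    rw [HomologicalComplex.exactAt_iff' _ (k + 1 + 1) (k + 1) k (by simp) (by simp)]
    have := exact_epi_kernel (p (k + 1)) (p (k + 2)) (ι k) (hd k)
    refine (ShortComplex.exact_iff_of_iso ?_).1 this
    refine ShortComplex.isoMk (Iso.refl _) (Iso.refl _) (Iso.refl _) ?_ ?_
    · exact (Category.id_comp _).trans ((hKd _).trans (Category.comp_id _).symm)
    · exact (Category.id_comp _).trans ((hKd _).trans (Category.comp_id _).symm)
  have h0 : K.d 1 0 ≫ p 0 = 0 := by
    rw [hKd]
    simp only [d, Category.assoc]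
    rw [hpι, comp_zero]
  have hπ : ((ChainComplex.toSingle₀Equiv K V).symm ⟨p 0, h0⟩).f 0 = p 0 :=
    ChainComplex.toSingle₀Equiv_symm_apply_f_zero _ _
  refine ⟨⟨K, fun k => hP _ _ _, (ChainComplex.toSingle₀Equiv _ _).symm ⟨p 0, h0⟩, ⟨fun k => ?_⟩⟩,
    fun k hk => hfg k _ _ hk⟩
  cases k with
  | zero =>
    rw [ChainComplex.quasiIsoAt₀_iff, ShortComplex.quasiIso_iff_of_zeros']
    · refine (ShortComplex.exact_and_epi_g_iff_of_iso ?_).2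
        ⟨exact_epi_kernel (p 0) (p 1) (𝟙 _) (by simp), ?_⟩
      · refine ShortComplex.isoMk (Iso.refl _) (Iso.refl _) (Iso.refl _) ?_ ?_
        · exact (Category.id_comp _).trans ((hKd 0).symm.trans (Category.comp_id _).symm)
        · refine (Category.id_comp _).trans (Eq.trans ?_ (Category.comp_id _).symm)
          exact (Category.comp_id (p 0)).trans hπ.symm
      · dsimp
        rw [Category.comp_id]
        exact hp 0
    all_goals rfl
  | succ k =>
    rw [quasiIsoAt_iff_exactAt']
    · exact hK k
    · apply ChainComplex.exactAt_succ_single_obj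

theorem moduleCat_hasTypeFP_iff {R : Type u} [Ring R] (n : ℕ∞) (A : ModuleCat.{u} R) :
    HasTypeFP (fun A : ModuleCat.{u} R => Module.Finite R A) n A ↔
      ∀ k : ℕ, (k : ℕ∞) ≤ n → FPn R k A := by
  constructor
  · rintro ⟨P, hP⟩ k hk
    refine FPn.of_resolution (fun i => P.complex.X i) (fun i => (P.complex.d (i + 1) i).hom)
      (P.π.f 0).hom ?_ ?_ ?_ ?_
    · exact (ModuleCat.epi_iff_surjective _).1 inferInstance
    · exact (ShortComplex.ShortExact.moduleCat_exact_iff_function_exact _).1 P.exact₀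
    · intro i
      exact (ShortComplex.ShortExact.moduleCat_exact_iff_function_exact _).1 (P.exact_succ i)
    · intro i hi
      have : Module.Finite R (P.complex.X i) := hP i (le_trans (by exact_mod_cast hi) hk)
      have : Module.Projective R (P.complex.X i) :=
        (IsProjective.iff_projective _).2 (P.projective i)
      exact FPn.projective _
  · intro h
    refine hasTypeFP_of_step _ n
      (fun k (V : ModuleCat.{u} R) => ∀ j : ℕ, ((k + j : ℕ) : ℕ∞) ≤ n → FPn R j V) ?_ A
      (fun j hj => h j (by simpa using hj))
    intro k V hV
    by_cases hk : (k : ℕ∞) ≤ n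
    · have : Module.Finite R V := hV 0 hk
      obtain ⟨r, f, hf⟩ := Module.Finite.exists_fin' R V
      refine ⟨ModuleCat.of R (Fin r → R), ?_, ModuleCat.ofHom f, ?_, fun _ => ?_, ?_⟩
      · exact (IsProjective.iff_projective _).1 inferInstance
      · exact (ModuleCat.epi_iff_surjective _).2 hf
      · exact inferInstanceAs (Module.Finite R (Fin r → R))
      · intro j hj
        have := FPn.kernel f hf (FPn.free j)
          (hV (j + 1) (by rwa [show k + (j + 1) = k + 1 + j by omega]))
        exact FPn.of_equiv (ModuleCat.kernelIsoKer (ModuleCat.ofHom f)).toLinearEquiv.symm this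
    -- Beyond degree `n`, any projective cover will do.
    · refine ⟨_, inferInstance, Projective.π V, inferInstance, fun h => absurd h hk, ?_⟩
      intro j hj
      exact absurd (le_trans (by exact_mod_cast (by omega : k ≤ k + 1 + j)) hj) hk

end Resolution

/-! ### Monoid rings and permutation modules -/

section MonoidRing

/-- The linear map of `ℤN`-modules given by an additive map that commutes with `N`. -/
noncomputable def asModuleHom {N : Type u} [Monoid N] {V W : Type u} [AddCommGroup V]
    [AddCommGroup W] (ρ : Representation ℤ N V) (σ : Representation ℤ N W) (φ : V →ₗ[ℤ] W)
    (h : ∀ n v, φ (ρ n v) = σ n (φ v)) : ρ.asModule →ₗ[MonoidAlgebra ℤ N] σ.asModule :=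
  Representation.IntertwiningMap.equivLinearMapAsModule ρ σ
    (φ.intertwiningMap_of_isIntertwiningMap ρ σ h)

theorem FPn.of_asModule_equiv {N : Type u} [Monoid N] {V W : Type u} [AddCommGroup V]
    [AddCommGroup W] (ρ : Representation ℤ N V) (σ : Representation ℤ N W) (φ : V ≃+ W)
    (h : ∀ n v, φ (ρ n v) = σ n (φ v)) {k : ℕ} (hV : FPn (MonoidAlgebra ℤ N) k ρ.asModule) :
    FPn (MonoidAlgebra ℤ N) k σ.asModule :=
  FPn.of_equiv (LinearEquiv.ofBijective (asModuleHom ρ σ φ.toIntLinearEquiv.toLinearMap h)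
    φ.bijective) hV

/-- The permutation representation of `N` on the free abelian group over an `N`-set. -/
noncomputable def permRep (N : Type u) [Monoid N] (X : Type u) [MulAction N X] :
    Representation ℤ N (X →₀ ℤ) where
  toFun n := Finsupp.lmapDomain ℤ ℤ (n • ·)
  map_one' := by
    refine LinearMap.ext fun v => ?_
    simp only [one_smul, Finsupp.lmapDomain_apply]
    exact Finsupp.mapDomain_id
  map_mul' a b := by
    refine LinearMap.ext fun v => ?_
    simp only [Finsupp.lmapDomain_apply, Module.End.mul_apply, mul_smul]
    exact Finsupp.mapDomain_comp (f := (b • ·)) (g := (a • ·))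

theorem permRep_single {N : Type u} [Monoid N] {X : Type u} [MulAction N X] (n : N) (x : X)
    (a : ℤ) : permRep N X n (Finsupp.single x a) = Finsupp.single (n • x) a :=
  Finsupp.mapDomain_single

/-- The permutation module `ℤX` over the monoid ring `ℤN`. -/
noncomputable abbrev PermModule (N : Type u) [Monoid N] (X : Type u) [MulAction N X] : Type u :=
  (permRep N X).asModule

/-- The basis element of the permutation module given by an element of `X`. -/
noncomputable def PermModule.basis (N : Type u) [Monoid N] {X : Type u} [MulAction N X] (x : X) :
    PermModule N X :=
  (permRep N X).asModuleEquiv.symm (Finsupp.single x 1)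

/-- The trivial `ℤN`-module `ℤ`. -/
noncomputable abbrev TrivialModule (N : Type u) [Monoid N] : Type u :=
  (Representation.trivial ℤ N (ULift.{u} ℤ)).asModule

variable {M N : Type u} [Monoid M] [Monoid N]

/-- The augmentation of the monoid ring. -/
noncomputable def augmentation (N : Type u) [Monoid N] : MonoidAlgebra ℤ N →ₐ[ℤ] ℤ :=
  MonoidAlgebra.lift ℤ ℤ N 1

theorem augmentation_single (n : N) (a : ℤ) :
    augmentation N (MonoidAlgebra.single n a) = a := by
  simp [augmentation]

theorem smul_trivialModule (r : MonoidAlgebra ℤ N) (v : ULift.{u} ℤ) :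
    r • (Representation.trivial ℤ N (ULift.{u} ℤ)).asModuleEquiv.symm v =
      (Representation.trivial ℤ N (ULift.{u} ℤ)).asModuleEquiv.symm (augmentation N r • v) := by
  induction r using MonoidAlgebra.induction_linear with
  | zero => simp
  | add x y hx hy => rw [add_smul, hx, hy, map_add, add_smul, map_add]
  | single n a =>
    rw [Representation.single_smul, augmentation_single, map_smul]
    rfl

namespace TrivialModule

/-- The generator of the trivial module `ℤ`. -/
noncomputable def one (N : Type u) [Monoid N] : TrivialModule N :=
  (Representation.trivial ℤ N (ULift.{u} ℤ)).asModuleEquiv.symm (ULift.up 1)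

theorem exists_smul_one (v : TrivialModule N) : ∃ r : MonoidAlgebra ℤ N, r • one N = v := by
  refine ⟨MonoidAlgebra.single 1
    ((Representation.trivial ℤ N (ULift.{u} ℤ)).asModuleEquiv v).down, ?_⟩
  rw [one, smul_trivialModule, augmentation_single, LinearEquiv.symm_apply_eq]
  apply ULift.ext
  simp

theorem smul_one_eq_zero_iff {r : MonoidAlgebra ℤ N} : r • one N = 0 ↔ augmentation N r = 0 := by
  rw [one, smul_trivialModule, LinearEquiv.map_eq_zero_iff]
  constructor
  · intro h
    have := congrArg ULift.down h
    simpa using this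
  · intro h
    rw [h, zero_smul]

end TrivialModule

namespace PermModule

variable {X : Type u} [MulAction M X]

theorem single_smul_basis [MulAction N X] (n : N) (a : ℤ) (x : X) :
    MonoidAlgebra.single n a • basis N x = a • basis N (n • x) := by
  rw [Representation.single_smul, basis, LinearEquiv.apply_symm_apply, permRep_single]
  rfl

theorem asModuleEquiv_smul_basis (a : ℤ) (x : X) :
    (permRep M X).asModuleEquiv (a • basis M x) = Finsupp.single x a := by
  rw [map_zsmul, basis, LinearEquiv.apply_symm_apply, Finsupp.smul_single, smul_eq_mul, mul_one]

/-- The ring homomorphism of monoid rings induced by `j` sends `y` to an element that acts on a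
fixed point of `j(N)` through the augmentation. -/
theorem mapDomain_smul_basis (j : N →* M) (x : X) (hj : ∀ n, j n • x = x)
    (y : MonoidAlgebra ℤ N) (g : M) :
    (MonoidAlgebra.single g 1 * MonoidAlgebra.mapDomainRingHom ℤ j y) • basis M x =
      augmentation N y • basis M (g • x) := by
  induction y using MonoidAlgebra.induction_linear with
  | zero => simp
  | add y z hy hz => rw [map_add, mul_add, add_smul, hy, hz, map_add, add_smul]
  | single n a =>
    rw [MonoidAlgebra.mapDomainRingHom_apply, MonoidAlgebra.mapDomain_single,
      MonoidAlgebra.single_mul_single, one_mul, single_smul_basis, mul_smul, augmentation_single,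
      hj]

end PermModule

theorem coeff_single_mul_mapDomain (j : N →* M) (c : M) (y : MonoidAlgebra ℤ N) :
    (MonoidAlgebra.single c 1 * MonoidAlgebra.mapDomainRingHom ℤ j y).coeff =
      Finsupp.mapDomain (fun n => c * j n) y.coeff := by
  induction y using MonoidAlgebra.induction_linear with
  | zero => simp
  | add y z hy hz =>
    rw [map_add, mul_add, MonoidAlgebra.coeff_add, hy, hz, MonoidAlgebra.coeff_add,
      Finsupp.mapDomain_add]
  | single n a =>
    rw [MonoidAlgebra.mapDomainRingHom_apply, MonoidAlgebra.mapDomain_single,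
      MonoidAlgebra.single_mul_single, one_mul, MonoidAlgebra.coeff_single,
      MonoidAlgebra.coeff_single, Finsupp.mapDomain_single]

section Coset

variable {X : Type u} [MulAction M X] (j : N →* M) (x : X)

/-- If any two elements of `M` with the same effect on `x` lie in a common coset `h j(N)`, then a
finite subset of `M` is covered by finitely many such cosets, one for each point of the orbit. -/
theorem exists_cosets (hj : ∀ n, j n • x = x)
    (hdir : ∀ g g' : M, g • x = g' • x → ∃ h n n', g = h * j n ∧ g' = h * j n') (T : Finset M) :
    ∃ C : Finset M, (∀ g ∈ T, ∃ c ∈ C, ∃ n, g = c * j n) ∧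
      ∀ c ∈ C, ∀ c' ∈ C, c • x = c' • x → c = c' := by
  classical
  induction T using Finset.induction_on with
  | empty => exact ⟨∅, by simp, by simp⟩
  | insert g T _ ih =>
    obtain ⟨C, hC, hC'⟩ := ih
    by_cases hg : ∃ c ∈ C, c • x = g • x
    · obtain ⟨c, hc, hcg⟩ := hg
      obtain ⟨h, n, n', rfl, rfl⟩ := hdir c g hcg
      rw [mul_smul, hj, mul_smul, hj] at hcg
      refine ⟨insert h (C.erase (h * j n)), ?_, ?_⟩
      · intro g hg
        rw [Finset.mem_insert] at hg
        rcases hg with rfl | hg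
        · exact ⟨h, Finset.mem_insert_self _ _, n', rfl⟩
        · obtain ⟨c, hc, m, rfl⟩ := hC g hg
          by_cases h1 : c = h * j n
          · exact ⟨h, Finset.mem_insert_self _ _, n * m, by rw [h1, map_mul, mul_assoc]⟩
          · exact ⟨c, Finset.mem_insert_of_mem (Finset.mem_erase.2 ⟨h1, hc⟩), m, rfl⟩
      · have hh : ∀ c ∈ C.erase (h * j n), c • x ≠ h • x := by
          intro c hc' hch
          rw [Finset.mem_erase] at hc'
          refine hc'.1 (hC' c hc'.2 _ hc ?_)
          rw [hch, mul_smul, hj]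
        intro c hc1 c' hc2 h12
        rw [Finset.mem_insert] at hc1 hc2
        rcases hc1 with rfl | hc1 <;> rcases hc2 with rfl | hc2
        · rfl
        · exact absurd h12.symm (hh _ hc2)
        · exact absurd h12 (hh _ hc1)
        · exact hC' _ (Finset.mem_of_mem_erase hc1) _ (Finset.mem_of_mem_erase hc2) h12
    · push Not at hg
      refine ⟨insert g C, ?_, ?_⟩
      · intro g' hg'
        rw [Finset.mem_insert] at hg'
        rcases hg' with rfl | hg'
        · exact ⟨g', Finset.mem_insert_self _ _, 1, by simp⟩
        · obtain ⟨c, hc, m, rfl⟩ := hC g' hg'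
          exact ⟨c, Finset.mem_insert_of_mem hc, m, rfl⟩
      · intro c hc1 c' hc2 h12
        rw [Finset.mem_insert] at hc1 hc2
        rcases hc1 with rfl | hc1 <;> rcases hc2 with rfl | hc2
        · rfl
        · exact absurd h12.symm (hg _ hc2)
        · exact absurd h12 (hg _ hc1)
        · exact hC' _ hc1 _ hc2 h12

theorem exists_coset_decomposition (hj : ∀ n, j n • x = x)
    (hinj : ∀ h n n', h * j n = h * j n' → n = n')
    (hdir : ∀ g g' : M, g • x = g' • x → ∃ h n n', g = h * j n ∧ g' = h * j n') (s : ℕ)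
    (r : Fin s → MonoidAlgebra ℤ M) :
    ∃ (C : Finset M) (y : C → Fin s → MonoidAlgebra ℤ N),
      (∀ i, r i = ∑ c : C, MonoidAlgebra.single c.1 1 *
        MonoidAlgebra.mapDomainRingHom ℤ j (y c i)) ∧
      (∀ c ∈ C, ∀ c' ∈ C, c • x = c' • x → c = c') ∧
      ∀ z : C → MonoidAlgebra ℤ N,
        ∑ c : C, MonoidAlgebra.single c.1 1 * MonoidAlgebra.mapDomainRingHom ℤ j (z c) = 0 →
          z = 0 := by
  classical
  obtain ⟨C, hC, hC'⟩ := exists_cosets j x hj hdir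
    (Finset.univ.biUnion fun i => (r i).coeff.support)
  have hcov : ∀ i, ∃ y : C → MonoidAlgebra ℤ N, r i = ∑ c : C, MonoidAlgebra.single c.1 1 *
      MonoidAlgebra.mapDomainRingHom ℤ j (y c) := by
    intro i
    rw [← MonoidAlgebra.sum_coeff_single (r i), Finsupp.sum]
    refine Finset.sum_induction (fun g => MonoidAlgebra.single g ((r i).coeff g))
      (fun w => ∃ y : C → MonoidAlgebra ℤ N, w = ∑ c : C, MonoidAlgebra.single c.1 1 *
        MonoidAlgebra.mapDomainRingHom ℤ j (y c)) ?_ ⟨0, by simp⟩ ?_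
    · rintro _ _ ⟨y, rfl⟩ ⟨z, rfl⟩
      refine ⟨y + z, ?_⟩
      rw [← Finset.sum_add_distrib]
      exact Finset.sum_congr rfl fun c _ => by rw [Pi.add_apply, map_add, mul_add]
    · intro g hg
      obtain ⟨c, hc, n, rfl⟩ := hC g (Finset.mem_biUnion.2 ⟨i, Finset.mem_univ _, hg⟩)
      refine ⟨Pi.single ⟨c, hc⟩ (MonoidAlgebra.single n ((r i).coeff (c * j n))), ?_⟩
      rw [Finset.sum_eq_single (⟨c, hc⟩ : C)]
      · rw [Pi.single_eq_same, MonoidAlgebra.mapDomainRingHom_apply,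
          MonoidAlgebra.mapDomain_single, MonoidAlgebra.single_mul_single, one_mul]
      · intro c' _ hc'
        rw [Pi.single_eq_of_ne hc', map_zero, mul_zero]
      · exact fun h => absurd (Finset.mem_univ _) h
  choose y hy using hcov
  refine ⟨C, fun c i => y i c, hy, hC', ?_⟩
  intro z hz
  funext c
  ext n
  have h1 := congrArg (fun w => w.coeff (c.1 * j n)) hz
  simp only [MonoidAlgebra.coeff_sum, Finsupp.finsetSum_apply, coeff_single_mul_mapDomain] at h1
  rw [Finset.sum_eq_single c] at h1
  · rw [Finsupp.mapDomain_apply (f := fun n => c.1 * j n) (fun a b hab => hinj _ _ _ hab)] at h1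
    exact h1
  · intro c' _ hc'
    refine Finsupp.mapDomain_of_notMem_range _ _ ?_
    rintro ⟨n', hn'⟩
    have hn : c'.1 * j n' = c.1 * j n := hn'
    refine hc' (Subtype.ext (hC' _ c'.2 _ c.2 ?_))
    have := congrArg (· • x) hn
    simpa only [mul_smul, hj] using this
  · exact fun h => absurd (Finset.mem_univ _) h

/-- If `j(N)` fixes the point `x` and plays the role of its stabilizer, then the cyclic permutation
module on the orbit of `x` is induced from the trivial `ℤN`-module, and inherits type `FP_k` from
it. -/
theorem FPn.span_basis (hj : ∀ n, j n • x = x)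
    (hinj : ∀ h n n', h * j n = h * j n' → n = n')
    (hdir : ∀ g g' : M, g • x = g' • x → ∃ h n n', g = h * j n ∧ g' = h * j n') {k : ℕ}
    (h : FPn (MonoidAlgebra ℤ N) k (TrivialModule N)) :
    FPn (MonoidAlgebra ℤ M) k
      (Submodule.span (MonoidAlgebra ℤ M) {PermModule.basis M x}) := by
  classical
  have hf : (MonoidAlgebra.mapDomainRingHom ℤ j).LocallyFree := by
    intro s r
    obtain ⟨C, y, h1, -, h3⟩ := exists_coset_decomposition j x hj hinj hdir s r
    exact ⟨C, inferInstance, fun c => MonoidAlgebra.single c.1 1, y, h1, h3⟩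
  refine extendScalars_cyclic hf (TrivialModule.one N)
    ⟨PermModule.basis M x, Submodule.mem_span_singleton_self _⟩
    TrivialModule.exists_smul_one ?_ ?_ ?_ h
  · rintro ⟨v, hv⟩
    obtain ⟨r, rfl⟩ := Submodule.mem_span_singleton.1 hv
    exact ⟨r, rfl⟩
  · intro s hs
    apply Subtype.ext
    change MonoidAlgebra.mapDomainRingHom ℤ j s • PermModule.basis M x = 0
    have := PermModule.mapDomain_smul_basis j x hj s 1
    rwa [TrivialModule.smul_one_eq_zero_iff.1 hs, zero_smul, ← MonoidAlgebra.one_def,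
      one_mul] at this
  · intro r hr
    have hr' : r • PermModule.basis M x = 0 := congrArg Subtype.val hr
    obtain ⟨C, y, h1, h2, -⟩ := exists_coset_decomposition j x hj hinj hdir 1 (fun _ => r)
    have h1 := h1 0
    rw [h1, Finset.sum_smul] at hr'
    simp only [PermModule.mapDomain_smul_basis j x hj] at hr'
    rw [h1]
    refine Submodule.sum_mem _ fun c _ => Submodule.smul_mem _ _ (Submodule.subset_span
      ⟨y c 0, TrivialModule.smul_one_eq_zero_iff.2 ?_, rfl⟩)
    have h4 := congrArg (fun v => (permRep M X).asModuleEquiv v (c.1 • x)) hr'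
    simp only [map_sum, PermModule.asModuleEquiv_smul_basis, Finsupp.finsetSum_apply] at h4
    rw [Finset.sum_eq_single c] at h4
    · simpa using h4
    · intro c' _ hc'
      refine Finsupp.single_eq_of_ne ?_
      exact fun h => hc' (Subtype.ext (h2 _ c'.2 _ c.2 h.symm))
    · exact fun h => absurd (Finset.mem_univ _) h

end Coset

end MonoidRing

/-! ### Permutation modules with finite stabilizers -/

section Orbits

theorem FPn.finset_sup {R : Type u} [Ring R] {A : Type u} [AddCommGroup A] [Module R A] {ι : Type*}
    [DecidableEq ι] (U : ι → Submodule R A) {k : ℕ} (h : ∀ i, FPn R k (U i))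
    (hU : ∀ (s : Finset ι) (i : ι), i ∉ s → Disjoint (U i) (s.sup U)) (s : Finset ι) :
    FPn R k (s.sup U : Submodule R A) := by
  induction s using Finset.induction_on with
  | empty =>
    rw [Finset.sup_empty]
    exact FPn.free k
  | insert i s hi ih =>
    rw [Finset.sup_insert]
    have hinj : Function.Injective ((U i).subtype.coprod (s.sup U).subtype) := by
      rw [← LinearMap.ker_eq_bot, LinearMap.ker_coprod_of_disjoint_range _ _ (by
        rw [Submodule.range_subtype, Submodule.range_subtype]
        exact hU s i hi), Submodule.ker_subtype, Submodule.ker_subtype, Submodule.prod_bot]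
    refine FPn.of_equiv ((LinearEquiv.ofInjective _ hinj).trans (LinearEquiv.ofEq _ _ ?_))
      (FPn.prod (h i) ih)
    rw [LinearMap.range_coprod, Submodule.range_subtype, Submodule.range_subtype]

/-- The submodule of a permutation module given by a subset that is stable under the monoid. -/
noncomputable def PermModule.supported {N : Type u} [Monoid N] {X : Type u} [MulAction N X]
    (Y : Set X) (hY : ∀ (n : N), ∀ y ∈ Y, n • y ∈ Y) :
    Submodule (MonoidAlgebra ℤ N) (PermModule N X) where
  carrier := {v | ((permRep N X).asModuleEquiv v) ∈ Finsupp.supported ℤ ℤ Y}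
  zero_mem' := by
    rw [Set.mem_ofPred_eq, map_zero]
    exact Submodule.zero_mem _
  add_mem' {a b} ha hb := by
    rw [Set.mem_ofPred_eq, map_add]
    exact Submodule.add_mem _ ha hb
  smul_mem' r v hv := by
    rw [Set.mem_ofPred_eq] at hv ⊢
    induction r using MonoidAlgebra.induction_linear with
    | zero =>
      rw [zero_smul, map_zero]
      exact Submodule.zero_mem _
    | add a b ha hb =>
      rw [add_smul, map_add]
      exact Submodule.add_mem _ ha hb
    | single n a =>
      rw [Representation.single_smul]
      refine Submodule.smul_mem _ a ?_
      change Finsupp.mapDomain (n • ·) ((permRep N X).asModuleEquiv v) ∈ _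
      exact Finsupp.supported_comap_lmapDomain ℤ ℤ (n • ·) Y
        (Finsupp.supported_mono (fun y hy => hY n y hy) hv)

instance isNoetherianRing_monoidAlgebra_finite (F : Type u) [Monoid F] [Finite F] :
    IsNoetherianRing (MonoidAlgebra ℤ F) :=
  isNoetherian_of_tower ℤ (inferInstanceAs (IsNoetherian ℤ (MonoidAlgebra ℤ F)))

instance TrivialModule.finite (N : Type u) [Monoid N] :
    Module.Finite (MonoidAlgebra ℤ N) (TrivialModule N) := by
  refine ⟨⟨{TrivialModule.one N}, ?_⟩⟩
  rw [Finset.coe_singleton, Submodule.eq_top_iff']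
  exact fun v => Submodule.mem_span_singleton.2 (TrivialModule.exists_smul_one v)

/-- A permutation module is of type `FP_k` for all `k` if its points are the multiples `n • x` of
points `x` of a set `X₀` that consists of finitely many orbits of invertible elements with finite
stabilizers, where `n` and `x` are unique up to invertible elements. Indeed, it is a
finite direct sum of modules induced from trivial modules of finite groups. -/
theorem PermModule.fpn_of_orbits {N : Type u} [Monoid N] [IsLeftCancelMul N] {X : Type u}
    [MulAction N X] (X₀ : Set X) (hcov : ∀ y : X, ∃ x ∈ X₀, ∃ n : N, n • x = y)
    (hunit : ∀ x ∈ X₀, ∀ x' ∈ X₀, ∀ n n' : N, n • x = n' • x' →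
      ∃ w : Nˣ, x' = w • x ∧ n = n' * w)
    (hfin : ((Quotient.mk (MulAction.orbitRel Nˣ X)) '' X₀).Finite)
    (hstab : ∀ x ∈ X₀, Finite (MulAction.stabilizer Nˣ x)) (k : ℕ) :
    FPn (MonoidAlgebra ℤ N) k (PermModule N X) := by
  classical
  -- The submodule generated by a point of `X₀` is induced from the stabilizer of the point.
  have hcyc : ∀ x ∈ X₀, FPn (MonoidAlgebra ℤ N) k
      (Submodule.span (MonoidAlgebra ℤ N) {PermModule.basis N x}) := by
    intro x hx
    have := hstab x hx
    refine FPn.span_basis ((Units.coeHom N).comp (MulAction.stabilizer Nˣ x).subtype) x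
      (fun w => w.2) ?_ ?_ (FPn.of_isNoetherianRing k)
    · intro h n n' hn
      exact Subtype.ext (Units.ext (mul_left_cancel hn))
    · intro g g' hg
      obtain ⟨w, hw, rfl⟩ := hunit x hx x hx g g' hg
      exact ⟨g', ⟨w, hw.symm⟩, 1, rfl, by simp⟩
  let I := (Quotient.mk (MulAction.orbitRel Nˣ X)) '' X₀
  have hI : Fintype I := hfin.fintype
  choose p hp hpI using fun q : I => q.2
  -- One such submodule for each orbit: they are independent and generate the permutation module.
  let U : I → Submodule (MonoidAlgebra ℤ N) (PermModule N X) := fun q =>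
    Submodule.span (MonoidAlgebra ℤ N) {PermModule.basis N (p q)}
  have hsub : ∀ (s : Finset I), s.sup U ≤ PermModule.supported
      {y | ∃ q ∈ s, ∃ n : N, n • p q = y} (by
        rintro n _ ⟨q, hq, n', rfl⟩
        exact ⟨q, hq, n * n', mul_smul _ _ _⟩) := by
    intro s
    refine Finset.sup_le fun q hq => (Submodule.span_singleton_le_iff_mem _ _).2 ?_
    change (permRep N X).asModuleEquiv (PermModule.basis N (p q)) ∈ _
    rw [PermModule.basis, LinearEquiv.apply_symm_apply]
    exact Finsupp.single_mem_supported ℤ (1 : ℤ) ⟨q, hq, 1, one_smul _ _⟩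
  have hind : ∀ (s : Finset I) (i : I), i ∉ s → Disjoint (U i) (s.sup U) := by
    intro s i hi
    rw [Submodule.disjoint_def]
    intro v hv1 hv2
    have h1 := hsub {i} (by rwa [Finset.sup_singleton])
    have h2 := hsub s hv2
    refine (permRep N X).asModuleEquiv.map_eq_zero_iff.1 ?_
    refine (Submodule.disjoint_def.1 (Finsupp.disjoint_supported_supported
      (M := ℤ) (R := ℤ) ?_)) _ h1 h2
    rw [Set.disjoint_left]
    rintro y ⟨q, hq, n, rfl⟩ ⟨q', hq', n', hn⟩
    obtain rfl := Finset.mem_singleton.1 hq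
    obtain ⟨w, hw, -⟩ := hunit _ (hp q) _ (hp q') n n' hn.symm
    refine hi ?_
    have : q' = q := by
      apply Subtype.ext
      rw [← hpI, ← hpI, hw]
      exact Quotient.sound ⟨w, rfl⟩
    rwa [← this]
  have htop : (Finset.univ.sup U) = ⊤ := by
    rw [Submodule.eq_top_iff']
    intro v
    have hb : ∀ x : X, PermModule.basis N x ∈ Finset.univ.sup U := by
      intro y
      obtain ⟨x, hx, n, rfl⟩ := hcov y
      let q : I := ⟨_, x, hx, rfl⟩
      obtain ⟨w, hw⟩ := Quotient.exact (hpI q)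
      refine Finset.le_sup (f := U) (Finset.mem_univ q) (Submodule.mem_span_singleton.2
        ⟨MonoidAlgebra.single (n * ((w⁻¹ : Nˣ) : N)) 1, ?_⟩)
      rw [PermModule.single_smul_basis, one_smul, mul_smul, ← hw]
      congr 2
      exact inv_smul_smul w x
    rw [← (permRep N X).asModuleEquiv.symm_apply_apply v]
    refine Finsupp.induction_linear
      (motive := fun w => (permRep N X).asModuleEquiv.symm w ∈ Finset.univ.sup U)
      ((permRep N X).asModuleEquiv v) ?_ ?_ ?_
    · rw [map_zero]
      exact Submodule.zero_mem _
    · intro a b ha hb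
      rw [map_add]
      exact Submodule.add_mem _ ha hb
    · intro x a
      rw [← PermModule.asModuleEquiv_smul_basis (M := N), LinearEquiv.symm_apply_apply]
      exact zsmul_mem (hb x) a
  have := FPn.finset_sup U (fun q => hcyc _ (hp q)) hind Finset.univ
  rw [htop] at this
  exact FPn.of_equiv Submodule.topEquiv this

end Orbits

/-! ### Characters and subgroups of finite index -/

section FiniteIndex

variable {G : Type u} [Group G] (χ : RealChar G) (H : Subgroup G)

theorem RealChar.mem_monoid {g : G} : g ∈ χ.monoid ↔ 0 ≤ (χ g).toAdd :=
  Iff.rfl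

/-- The inclusion of `H_χ` in `G_χ`. -/
def RealChar.resMonoidHom : (χ.res H).monoid →* χ.monoid where
  toFun n := ⟨n.1.1, n.2⟩
  map_one' := rfl
  map_mul' _ _ := rfl

theorem RealChar.resMonoidHom_coe (n : (χ.res H).monoid) : (χ.resMonoidHom H n : G) = n.1.1 :=
  rfl

theorem RealChar.exists_pos (hχ : χ ≠ 1) [H.FiniteIndex] : ∃ t ∈ H, 0 < (χ t).toAdd := by
  obtain ⟨g, hg⟩ := DFunLike.ne_iff.1 hχ
  have hg' : (χ g).toAdd ≠ 0 := hg
  obtain ⟨k, hk, -, hkH⟩ := Subgroup.exists_pow_mem_of_index_ne_zero (H := H)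
    Subgroup.FiniteIndex.index_ne_zero g
  rcases lt_or_gt_of_ne hg' with h | h
  · refine ⟨(g ^ k)⁻¹, H.inv_mem hkH, ?_⟩
    rw [map_inv, map_pow, toAdd_inv, toAdd_pow, nsmul_eq_mul, Left.neg_pos_iff]
    exact mul_neg_of_pos_of_neg (by exact_mod_cast hk) h
  · refine ⟨g ^ k, hkH, ?_⟩
    rw [map_pow, toAdd_pow, nsmul_eq_mul]
    exact mul_pos (by exact_mod_cast hk) h

theorem smul_basis_quotient [H.Normal] (r : MonoidAlgebra ℤ χ.monoid) :
    (permRep χ.monoid (G ⧸ H)).asModuleEquiv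
      (r • PermModule.basis χ.monoid ((1 : G) : G ⧸ H)) =
      (MonoidAlgebra.mapDomainRingHom ℤ ((QuotientGroup.mk' H).comp χ.monoid.subtype) r).coeff := by
  induction r using MonoidAlgebra.induction_linear with
  | zero => simp
  | add a b ha hb => rw [add_smul, map_add, ha, hb, map_add, MonoidAlgebra.coeff_add]
  | single n a =>
    rw [PermModule.single_smul_basis, PermModule.asModuleEquiv_smul_basis,
      MonoidAlgebra.mapDomainRingHom_apply, MonoidAlgebra.mapDomain_single,
      MonoidAlgebra.coeff_single]
    congr 1
    change ((n.1 * 1 : G) : G ⧸ H) = (n.1 : G ⧸ H)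
    rw [mul_one]

/-- Type `FP_k` passes from `H_χ` to `G_χ`: the induced module is `ℤ[G/H]`, and the trivial
module is finitely generated over the noetherian ring `ℤ[G/H]`, a quotient of `ℤG_χ`. -/
theorem RealChar.fpn_of_res [H.Normal] [H.FiniteIndex] {k : ℕ}
    (h : FPn (MonoidAlgebra ℤ (χ.res H).monoid) k (TrivialModule (χ.res H).monoid)) :
    FPn (MonoidAlgebra ℤ χ.monoid) k (TrivialModule χ.monoid) := by
  have h1 := FPn.span_basis (X := G ⧸ H) (χ.resMonoidHom H) ((1 : G) : G ⧸ H) ?_ ?_ ?_ h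
  · let J := RingHom.ker
      (MonoidAlgebra.mapDomainRingHom ℤ ((QuotientGroup.mk' H).comp χ.monoid.subtype))
    let l := LinearMap.toSpanSingleton (MonoidAlgebra ℤ χ.monoid) _
      (PermModule.basis χ.monoid ((1 : G) : G ⧸ H))
    have hl : LinearMap.ker l = J := by
      ext r
      rw [LinearMap.mem_ker, RingHom.mem_ker, LinearMap.toSpanSingleton_apply,
        ← LinearEquiv.map_eq_zero_iff (permRep χ.monoid (G ⧸ H)).asModuleEquiv,
        smul_basis_quotient, MonoidAlgebra.coeff_eq_zero]
    have e : (MonoidAlgebra ℤ χ.monoid ⧸ J) ≃ₗ[MonoidAlgebra ℤ χ.monoid] _ :=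
      (Submodule.quotEquivOfEq _ _ hl.symm).trans (LinearMap.quotKerEquivRange l)
    have h2 : FPn (MonoidAlgebra ℤ χ.monoid) k (MonoidAlgebra ℤ χ.monoid ⧸ J) := by
      rw [LinearMap.span_singleton_eq_range] at h1
      exact FPn.of_equiv e.symm h1
    have h3 : IsNoetherian (MonoidAlgebra ℤ χ.monoid) (PermModule χ.monoid (G ⧸ H)) :=
      isNoetherian_of_tower ℤ (isNoetherian_of_linearEquiv
        (permRep χ.monoid (G ⧸ H)).asModuleEquiv.symm)
    have h4 : IsNoetherian (MonoidAlgebra ℤ χ.monoid) (MonoidAlgebra ℤ χ.monoid ⧸ J) :=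
      isNoetherian_of_linearEquiv e.symm
    -- The kernel `J` of `ℤG_χ → ℤ[G/H]` acts trivially on `ℤ`, as it lies in the augmentation
    -- ideal.
    refine FPn.of_isNoetherian_quotient J h2 ?_
    intro r hr v
    have h6 : augmentation χ.monoid r = 0 := by
      have : (augmentation χ.monoid : MonoidAlgebra ℤ χ.monoid →+* ℤ) =
          (augmentation (G ⧸ H) : MonoidAlgebra ℤ (G ⧸ H) →+* ℤ).comp
            (MonoidAlgebra.mapDomainRingHom ℤ ((QuotientGroup.mk' H).comp χ.monoid.subtype)) := by
        refine MonoidAlgebra.ringHom_ext (fun a => ?_) (fun a => ?_) <;>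
        simp [augmentation]
      have h7 := RingHom.congr_fun this r
      rw [RingHom.comp_apply, RingHom.mem_ker.1 hr, map_zero] at h7
      exact h7
    rw [← (Representation.trivial ℤ χ.monoid (ULift.{u} ℤ)).asModuleEquiv.symm_apply_apply v,
      smul_trivialModule, h6, zero_smul, map_zero]
  · rintro ⟨⟨n, hn⟩, hn'⟩
    change ((n * 1 : G) : G ⧸ H) = ((1 : G) : G ⧸ H)
    rw [mul_one]
    exact (QuotientGroup.eq_one_iff n).2 hn
  · intro h n n' hn
    have := mul_left_cancel (congrArg Subtype.val hn)
    exact Subtype.ext (Subtype.ext this)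
  · rintro ⟨g, hg⟩ ⟨g', hg'⟩ h
    change ((g * 1 : G) : G ⧸ H) = ((g' * 1 : G) : G ⧸ H) at h
    rw [mul_one, mul_one, QuotientGroup.eq] at h
    -- Two elements of a coset of `H` are multiples of the one with the smaller value.
    rcases le_total (χ g).toAdd (χ g').toAdd with hle | hle
    · refine ⟨⟨g, hg⟩, 1, ⟨⟨g⁻¹ * g', h⟩, ?_⟩, by simp, ?_⟩
      · change 0 ≤ (χ (g⁻¹ * g')).toAdd
        rw [map_mul, map_inv, toAdd_mul, toAdd_inv]
        linarith
      · exact Subtype.ext (mul_inv_cancel_left g g').symm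
    · have h' : g'⁻¹ * g ∈ H := by simpa using H.inv_mem h
      refine ⟨⟨g', hg'⟩, ⟨⟨g'⁻¹ * g, h'⟩, ?_⟩, 1, ?_, by simp⟩
      · change 0 ≤ (χ (g'⁻¹ * g)).toAdd
        rw [map_mul, map_inv, toAdd_mul, toAdd_inv]
        linarith
      · exact Subtype.ext (mul_inv_cancel_left g' g).symm

theorem coeff_mapDomain_mul_single {M N : Type u} [Monoid M] [Monoid N] (j : N →* M) (c : M)
    (y : MonoidAlgebra ℤ N) :
    (MonoidAlgebra.mapDomainRingHom ℤ j y * MonoidAlgebra.single c 1).coeff =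
      Finsupp.mapDomain (fun n => j n * c) y.coeff := by
  induction y using MonoidAlgebra.induction_linear with
  | zero => simp
  | add y z hy hz =>
    rw [map_add, add_mul, MonoidAlgebra.coeff_add, hy, hz, MonoidAlgebra.coeff_add,
      Finsupp.mapDomain_add]
  | single n a =>
    rw [MonoidAlgebra.mapDomainRingHom_apply, MonoidAlgebra.mapDomain_single,
      MonoidAlgebra.single_mul_single, mul_one, MonoidAlgebra.coeff_single,
      MonoidAlgebra.coeff_single, Finsupp.mapDomain_single]

/-- The cosets of `H` have representatives with values in the interval `[0, χ(t)]`. -/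
theorem RealChar.exists_section {t : G} (htH : t ∈ H) (ht : 0 < (χ t).toAdd) :
    ∃ s : G ⧸ H → G, (∀ q, (s q : G ⧸ H) = q) ∧ ∀ q, 0 ≤ (χ (s q)).toAdd ∧
      (χ (s q)).toAdd ≤ (χ t).toAdd := by
  have : ∀ q : G ⧸ H, ∃ g : G, (g : G ⧸ H) = q ∧ 0 ≤ (χ g).toAdd ∧
      (χ g).toAdd ≤ (χ t).toAdd := by
    intro q
    obtain ⟨g, rfl⟩ := QuotientGroup.mk_surjective q
    obtain ⟨m, hm, -⟩ := existsUnique_add_zsmul_mem_Ico ht (χ g).toAdd 0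
    refine ⟨g * t ^ m, ?_, ?_⟩
    · exact QuotientGroup.mk_mul_of_mem g (H.zpow_mem htH m)
    · rw [map_mul, map_zpow, toAdd_mul, toAdd_zpow]
      rw [zero_add] at hm
      exact ⟨hm.1, hm.2.le⟩
  choose s hs hs' using this
  exact ⟨s, hs, hs'⟩

/-- Type `FP_k` passes from `G_χ` to `H_χ`. -/
theorem RealChar.fpn_res [H.Normal] [H.FiniteIndex] (hχ : χ ≠ 1) {k : ℕ}
    (h : FPn (MonoidAlgebra ℤ χ.monoid) k (TrivialModule χ.monoid)) :
    FPn (MonoidAlgebra ℤ (χ.res H).monoid) k (TrivialModule (χ.res H).monoid) := by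
  classical
  obtain ⟨t, htH, htχ⟩ := χ.exists_pos H hχ
  obtain ⟨s, hs, hs'⟩ := χ.exists_section H htH htχ
  let f := MonoidAlgebra.mapDomainRingHom ℤ (χ.resMonoidHom H)
  let _ : Module (MonoidAlgebra ℤ (χ.res H).monoid) (MonoidAlgebra ℤ χ.monoid) :=
    Module.compHom _ f
  let _ : Module (MonoidAlgebra ℤ (χ.res H).monoid) (TrivialModule χ.monoid) :=
    Module.compHom _ f
  have hsmul : ∀ (a : MonoidAlgebra ℤ (χ.res H).monoid) (r : MonoidAlgebra ℤ χ.monoid),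
      a • r = f a * r := fun _ _ => rfl
  have hsmul' : ∀ (a : MonoidAlgebra ℤ (χ.res H).monoid) (v : TrivialModule χ.monoid),
      a • v = f a • v := fun _ _ => rfl
  have : IsScalarTower (MonoidAlgebra ℤ (χ.res H).monoid) (MonoidAlgebra ℤ χ.monoid)
      (MonoidAlgebra ℤ χ.monoid) := ⟨fun a b c => mul_assoc (f a) b c⟩
  have : IsScalarTower (MonoidAlgebra ℤ (χ.res H).monoid) (MonoidAlgebra ℤ χ.monoid)
      (TrivialModule χ.monoid) := ⟨fun a b c => mul_smul (f a) b c⟩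
  -- `FPn.descent` is applied to `t`, which normalizes the subring `ℤH_χ` and acts trivially on `ℤ`.
  let t₀ : χ.monoid := ⟨t, htχ.le⟩
  let t₁ : MonoidAlgebra ℤ χ.monoid := MonoidAlgebra.single t₀ 1
  have ht₁ : ∀ c : ℕ, t₁ ^ c = MonoidAlgebra.single (t₀ ^ c) 1 := fun c => by
    rw [MonoidAlgebra.single_pow, one_pow]
  have hconj : ∀ n : (χ.res H).monoid, ∃ n' : (χ.res H).monoid,
      χ.resMonoidHom H n * t₀ = t₀ * χ.resMonoidHom H n' := by
    rintro ⟨⟨n, hn⟩, hn'⟩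
    refine ⟨⟨⟨t⁻¹ * n * t, H.mul_mem (H.mul_mem (H.inv_mem htH) hn) htH⟩, ?_⟩, ?_⟩
    · change 0 ≤ (χ (t⁻¹ * n * t)).toAdd
      have : 0 ≤ (χ n).toAdd := hn'
      simp only [map_mul, map_inv, toAdd_mul, toAdd_inv]
      linarith
    · apply Subtype.ext
      change n * t = t * (t⁻¹ * n * t)
      group
  have ht : ∀ a : MonoidAlgebra ℤ (χ.res H).monoid, ∃ a' : MonoidAlgebra ℤ (χ.res H).monoid,
      a • t₁ = t₁ * (a' • (1 : MonoidAlgebra ℤ χ.monoid)) := by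
    intro a
    induction a using MonoidAlgebra.induction_linear with
    | zero => exact ⟨0, by simp⟩
    | add a b ha hb =>
      obtain ⟨a', ha⟩ := ha
      obtain ⟨b', hb⟩ := hb
      exact ⟨a' + b', by rw [add_smul, ha, hb, add_smul, mul_add]⟩
    | single n z =>
      obtain ⟨n', hn'⟩ := hconj n
      refine ⟨MonoidAlgebra.single n' z, ?_⟩
      rw [hsmul, hsmul, mul_one, MonoidAlgebra.mapDomainRingHom_apply,
        MonoidAlgebra.mapDomain_single, MonoidAlgebra.mapDomainRingHom_apply,
        MonoidAlgebra.mapDomain_single, MonoidAlgebra.single_mul_single,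
        MonoidAlgebra.single_mul_single, hn', mul_one, one_mul]
  have htR : ∀ x : MonoidAlgebra ℤ χ.monoid, t₁ * x = 0 → x = 0 := by
    intro x hx
    have h1 := coeff_single_mul_mapDomain (MonoidHom.id χ.monoid) t₀ x
    rw [MonoidAlgebra.mapDomainRingHom_id, RingHom.id_apply, hx, MonoidAlgebra.coeff_zero] at h1
    rw [← MonoidAlgebra.coeff_eq_zero]
    refine Finsupp.mapDomain_injective (f := fun n => t₀ * MonoidHom.id χ.monoid n)
      (fun a b hab => mul_left_cancel hab) ?_
    rw [← h1, Finsupp.mapDomain_zero]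
  have hfix : ∀ v : TrivialModule χ.monoid, t₁ • v = v := by
    intro v
    rw [← (Representation.trivial ℤ χ.monoid (ULift.{u} ℤ)).asModuleEquiv.symm_apply_apply v,
      smul_trivialModule, augmentation_single, one_smul]
  have hP : ∀ c : ℕ, ∃ P : Submodule (MonoidAlgebra ℤ (χ.res H).monoid) (MonoidAlgebra ℤ χ.monoid),
      Module.Free (MonoidAlgebra ℤ (χ.res H).monoid) P ∧
      Module.Finite (MonoidAlgebra ℤ (χ.res H).monoid) P ∧
      P ≤ powSMul t₁ ht (MonoidAlgebra ℤ χ.monoid) c ∧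
      powSMul t₁ ht (MonoidAlgebra ℤ χ.monoid) (c + 1) ≤ P := by
    intro c
    -- `P` has the basis `t^c s(q)`. It contains `t^{c+1} g` for `χ(g) ≥ 0`, since the factor `t`
    -- makes up for the value of the representative `s(q)` of the coset of `g`.
    let m : G ⧸ H → χ.monoid := fun q => t₀ ^ c * ⟨s q, (hs' q).1⟩
    have hmk : ∀ (n : (χ.res H).monoid) (q : G ⧸ H),
        ((χ.resMonoidHom H n * m q : χ.monoid) : G) = n.1.1 * (t ^ c * s q) := fun n q => by
      simp [m, t₀, RealChar.resMonoidHom_coe]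
    have hq : ∀ (n : (χ.res H).monoid) (q : G ⧸ H),
        (((χ.resMonoidHom H n * m q : χ.monoid) : G) : G ⧸ H) = q := by
      intro n q
      have h1 : ((n.1.1 : G) : G ⧸ H) = 1 := (QuotientGroup.eq_one_iff _).2 n.1.2
      have h2 : ((t ^ c : G) : G ⧸ H) = 1 := (QuotientGroup.eq_one_iff _).2 (H.pow_mem htH c)
      rw [hmk, QuotientGroup.mk_mul, QuotientGroup.mk_mul, h1, h2, one_mul, one_mul, hs]
    have _ : Fintype (G ⧸ H) := Fintype.ofFinite _
    let L : (G ⧸ H → MonoidAlgebra ℤ (χ.res H).monoid) →ₗ[MonoidAlgebra ℤ (χ.res H).monoid]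
        MonoidAlgebra ℤ χ.monoid :=
      Fintype.linearCombination _ (fun q => MonoidAlgebra.single (m q) 1)
    have hL : ∀ y, L y = ∑ q, f (y q) * MonoidAlgebra.single (m q) 1 := fun y =>
      Fintype.linearCombination_apply _ _ _
    have hLinj : Function.Injective L := by
      rw [← LinearMap.ker_eq_bot, LinearMap.ker_eq_bot']
      intro y hy
      funext q
      ext n
      have h1 := congrArg (fun w => w.coeff (χ.resMonoidHom H n * m q)) hy
      simp only [hL, MonoidAlgebra.coeff_sum, Finsupp.finsetSum_apply, f,
        coeff_mapDomain_mul_single] at h1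
      rw [Finset.sum_eq_single q] at h1
      · rw [Finsupp.mapDomain_apply (f := fun n => χ.resMonoidHom H n * m q)] at h1
        · exact h1
        · intro a b hab
          have := mul_right_cancel hab
          exact Subtype.ext (Subtype.ext (congrArg (fun w : χ.monoid => (w : G)) this))
      · intro q' _ hq'
        refine Finsupp.mapDomain_of_notMem_range _ _ ?_
        rintro ⟨n', hn'⟩
        have hn : χ.resMonoidHom H n' * m q' = χ.resMonoidHom H n * m q := hn'
        exact hq' (by rw [← hq n' q', hn, hq])
      · exact fun h => absurd (Finset.mem_univ _) h
    refine ⟨LinearMap.range L, Module.Free.of_equiv (LinearEquiv.ofInjective L hLinj),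
      Module.Finite.range L, ?_, ?_⟩
    · rintro _ ⟨y, rfl⟩
      rw [Fintype.linearCombination_apply]
      refine Submodule.sum_mem _ fun q _ => Submodule.smul_mem _ _ ?_
      refine ⟨MonoidAlgebra.single ⟨s q, (hs' q).1⟩ 1, ?_⟩
      rw [ht₁, smul_eq_mul, MonoidAlgebra.single_mul_single, one_mul]
    · rintro _ ⟨r, rfl⟩
      induction r using MonoidAlgebra.induction_linear with
      | zero =>
        rw [smul_zero]
        exact Submodule.zero_mem _
      | add a b ha hb =>
        rw [smul_add]
        exact Submodule.add_mem _ ha hb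
      | single g z =>
        obtain ⟨g, hg⟩ := g
        have hg' : 0 ≤ (χ g).toAdd := hg
        let q : G ⧸ H := g
        have hnH : t ^ (c + 1) * g * (s q)⁻¹ * (t ^ c)⁻¹ ∈ H := by
          have h2 : ∀ c : ℕ, ((t ^ c : G) : G ⧸ H) = 1 := fun c =>
            (QuotientGroup.eq_one_iff _).2 (H.pow_mem htH c)
          rw [← QuotientGroup.eq_one_iff]
          simp only [QuotientGroup.mk_mul, QuotientGroup.mk_inv, h2, hs, q]
          simp
        refine ⟨Pi.single q (MonoidAlgebra.single ⟨⟨_, hnH⟩, ?_⟩ z), ?_⟩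
        · change 0 ≤ (χ (t ^ (c + 1) * g * (s q)⁻¹ * (t ^ c)⁻¹)).toAdd
          have := (hs' q).2
          simp only [map_mul, map_inv, map_pow, toAdd_mul, toAdd_inv, toAdd_pow, succ_nsmul]
          linarith
        · rw [hL, Finset.sum_eq_single q]
          · rw [Pi.single_eq_same, MonoidAlgebra.mapDomainRingHom_apply,
              MonoidAlgebra.mapDomain_single, MonoidAlgebra.single_mul_single, mul_one, ht₁,
              smul_eq_mul, MonoidAlgebra.single_mul_single, one_mul]
            congr 1
            apply Subtype.ext
            rw [hmk]
            simp [t₀, mul_assoc]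
          · intro q' _ hq'
            rw [Pi.single_eq_of_ne hq', map_zero, zero_mul]
          · exact fun h => absurd (Finset.mem_univ _) h
  have h1 := FPn.descent htR hP h hfix
  refine FPn.of_equiv (LinearEquiv.ofBijective (M := TrivialModule χ.monoid)
    (M₂ := TrivialModule (χ.res H).monoid)
    { toFun := fun v => v, map_add' := fun _ _ => rfl, map_smul' := ?_ } Function.bijective_id) h1
  intro a v
  have haug : augmentation χ.monoid (f a) = augmentation (χ.res H).monoid a := by
    induction a using MonoidAlgebra.induction_linear with
    | zero => simp
    | add a b ha hb => rw [map_add, map_add, map_add, ha, hb]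
    | single n z =>
      rw [MonoidAlgebra.mapDomainRingHom_apply, MonoidAlgebra.mapDomain_single,
        augmentation_single, augmentation_single]
  exact (smul_trivialModule (f a) v).trans ((congrArg (fun z : ℤ => z • v) haug).trans
    (smul_trivialModule (N := (χ.res H).monoid) a v).symm)

end FiniteIndex

/-! ### The orbit category and evaluation of Bredon modules -/

section Bredon

open Opposite

variable {M : Type u} [Monoid M]

namespace FiniteSubgroup

/-- The coset `mK`. -/
def coset (K : FiniteSubgroup M) (m : M) : K.Cosets := Quotient.mk K.cosetSetoid m

theorem coset_eq_iff (K : FiniteSubgroup M) {a b : M} :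
    K.coset a = K.coset b ↔ ∃ k ∈ K.toSubmonoid, a * k = b :=
  Quotient.eq

theorem smul_coset (K : FiniteSubgroup M) (x m : M) : x • K.coset m = K.coset (x * m) :=
  rfl

theorem exists_coset (K : FiniteSubgroup M) (c : K.Cosets) : ∃ m, K.coset m = c :=
  Quotient.exists_rep c

/-- The map `M/K → M/L`, `xK ↦ xmL`, for an element `m` with `Km ⊆ mL`. -/
def cosetMap (K L : FiniteSubgroup M) (m : M)
    (h : ∀ k ∈ K.toSubmonoid, ∃ l ∈ L.toSubmonoid, k * m = m * l) : K.Cosets →[M] L.Cosets where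
  toFun := Quotient.map (fun x => x * m) (by
    rintro x _ ⟨k, hk, rfl⟩
    obtain ⟨l, hl, hkl⟩ := h k hk
    exact ⟨l, hl, by rw [mul_assoc x k m, hkl, mul_assoc]⟩)
  map_smul' := by
    rintro y ⟨x⟩
    exact congrArg L.coset (mul_assoc y x m)

theorem cosets_hom_ext {K L : FiniteSubgroup M} {f g : K.Cosets →[M] L.Cosets}
    (h : f (K.coset 1) = g (K.coset 1)) : f = g := by
  apply MulActionHom.ext
  intro c
  obtain ⟨m, rfl⟩ := K.exists_coset c
  rw [← mul_one m, ← smul_coset, map_smul, map_smul, h]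

theorem mul_of_hom {K L : FiniteSubgroup M} (f : K.Cosets →[M] L.Cosets) {m : M}
    (hm : f (K.coset 1) = L.coset m) : ∀ k ∈ K.toSubmonoid, ∃ l ∈ L.toSubmonoid, k * m = m * l := by
  intro k hk
  have h1 : k • K.coset 1 = K.coset 1 := by
    rw [smul_coset, mul_one]
    exact (K.coset_eq_iff.2 ⟨k, hk, one_mul k⟩).symm
  have h2 := congrArg f h1
  rw [map_smul, hm, smul_coset] at h2
  obtain ⟨l, hl, h3⟩ := L.coset_eq_iff.1 h2.symm
  exact ⟨l, hl, h3.symm⟩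

/-- The submonoid of all `m` with `Km ⊆ mK`. -/
def normalizer (K : FiniteSubgroup M) : Submonoid M where
  carrier := {m | ∀ k ∈ K.toSubmonoid, ∃ l ∈ K.toSubmonoid, k * m = m * l}
  one_mem' := fun k hk => ⟨k, hk, by rw [mul_one, one_mul]⟩
  mul_mem' := by
    intro a b ha hb k hk
    obtain ⟨l, hl, h1⟩ := ha k hk
    obtain ⟨l', hl', h2⟩ := hb l hl
    exact ⟨l', hl', by rw [← mul_assoc, h1, mul_assoc, h2, mul_assoc]⟩

end FiniteSubgroup

namespace OrbitCategory

/-- The endomorphism `xK ↦ xmK` of `M/K` for an element of the normalizer of `K`. -/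
def endo (T : OrbitCategory M) (n : T.sub.normalizer) : T ⟶ T :=
  T.sub.cosetMap T.sub n.1 n.2

theorem endo_one (T : OrbitCategory M) : T.endo 1 = 𝟙 T :=
  FiniteSubgroup.cosets_hom_ext (congrArg T.sub.coset (mul_one 1))

theorem endo_mul (T : OrbitCategory M) (a b : T.sub.normalizer) :
    T.endo (a * b) = T.endo a ≫ T.endo b :=
  FiniteSubgroup.cosets_hom_ext (congrArg T.sub.coset (mul_assoc 1 a.1 b.1).symm)

/-- The set of all morphisms from `T` to the members of a family of objects. -/
structure Homs {ι : Type u} (T : OrbitCategory M) (K : ι → OrbitCategory M) : Type u where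
  idx : ι
  hom : T ⟶ K idx

/-- Precomposition of morphisms to the members of a family of objects. -/
def Homs.precomp {ι : Type u} {S T : OrbitCategory M} {K : ι → OrbitCategory M} (f : S ⟶ T)
    (p : T.Homs K) : S.Homs K :=
  ⟨p.idx, f ≫ p.hom⟩

theorem Homs.precomp_id {ι : Type u} {T : OrbitCategory M} {K : ι → OrbitCategory M}
    (p : T.Homs K) : p.precomp (𝟙 T) = p := by
  rw [precomp, Category.id_comp]

theorem Homs.precomp_comp {ι : Type u} {R S T : OrbitCategory M} {K : ι → OrbitCategory M}
    (f : R ⟶ S) (g : S ⟶ T) (p : T.Homs K) : p.precomp (f ≫ g) = (p.precomp g).precomp f := by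
  rw [precomp, Category.assoc]
  rfl

instance {ι : Type u} (T : OrbitCategory M) (K : ι → OrbitCategory M) :
    MulAction T.sub.normalizer (T.Homs K) where
  smul n p := p.precomp (T.endo n)
  one_smul p := by
    change p.precomp (T.endo 1) = p
    rw [endo_one, Homs.precomp_id]
  mul_smul a b p := by
    change p.precomp (T.endo (a * b)) = (p.precomp (T.endo b)).precomp (T.endo a)
    rw [endo_mul, Homs.precomp_comp]

end OrbitCategory

namespace BredonModule

/-- The value of a Bredon module at `M/K`, as a representation of the normalizer of `K`. -/
noncomputable def evalRep (V : BredonModule M) (T : OrbitCategory M) :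
    Representation ℤ T.sub.normalizer (V.obj (op T)) where
  toFun n := (V.map (T.endo n).op).hom.toIntLinearMap
  map_one' := by
    refine LinearMap.ext fun v => ?_
    rw [T.endo_one, op_id, V.map_id]
    rfl
  map_mul' a b := by
    refine LinearMap.ext fun v => ?_
    rw [T.endo_mul, op_comp, V.map_comp]
    rfl

/-- The value of a Bredon module at `M/K`, as a module over the monoid ring of the normalizer. -/
noncomputable abbrev eval (V : BredonModule M) (T : OrbitCategory M) : Type u :=
  (V.evalRep T).asModule

/-- The linear map on values given by a morphism of Bredon modules. -/
noncomputable def evalMap {V W : BredonModule M} (f : V ⟶ W) (T : OrbitCategory M) :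
    V.eval T →ₗ[MonoidAlgebra ℤ T.sub.normalizer] W.eval T :=
  asModuleHom (V.evalRep T) (W.evalRep T) (f.app (op T)).hom.toIntLinearMap (by
    intro n v
    exact ConcreteCategory.congr_hom (f.naturality (T.endo n).op) v)

theorem evalMap_surjective {V W : BredonModule M} (f : V ⟶ W) [Epi f] (T : OrbitCategory M) :
    Function.Surjective (evalMap f T) :=
  (AddCommGrpCat.epi_iff_surjective _).1 ((NatTrans.epi_iff_epi_app f).1 inferInstance (op T))

theorem evalMap_injective {V W : BredonModule M} (f : V ⟶ W) [Mono f] (T : OrbitCategory M) :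
    Function.Injective (evalMap f T) :=
  (AddCommGrpCat.mono_iff_injective _).1 ((NatTrans.mono_iff_mono_app f).1 inferInstance (op T))

theorem evalMap_exact {S : ShortComplex (BredonModule M)} (hS : S.Exact) (T : OrbitCategory M) :
    Function.Exact (evalMap S.f T) (evalMap S.g T) :=
  (ShortComplex.ab_exact_iff_function_exact _).1
    (hS.map ((evaluation (OrbitCategory M)ᵒᵖ AddCommGrpCat.{u}).obj (op T)))

theorem epi_of_surjective {V W : BredonModule M} (f : V ⟶ W)
    (h : ∀ T : OrbitCategory M, Function.Surjective (f.app (op T))) : Epi f :=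
  (NatTrans.epi_iff_epi_app f).2 fun T => (AddCommGrpCat.epi_iff_surjective _).2 (h T.unop)

/-- The free Bredon module on a family of generators `e_i` at the objects `K i`; its value at `T` is
the free abelian group on the set of all morphisms `T ⟶ K i`. -/
noncomputable def free {ι : Type u} (K : ι → OrbitCategory M) : BredonModule M where
  obj T := AddCommGrpCat.of (T.unop.Homs K →₀ ℤ)
  map f := AddCommGrpCat.ofHom (Finsupp.mapDomain.addMonoidHom (OrbitCategory.Homs.precomp f.unop))
  map_id T := by
    apply AddCommGrpCat.hom_ext
    refine AddMonoidHom.ext fun (v : T.unop.Homs K →₀ ℤ) => ?_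
    change Finsupp.mapDomain _ v = v
    have : OrbitCategory.Homs.precomp (K := K) (𝟙 T.unop) = id :=
      funext OrbitCategory.Homs.precomp_id
    rw [unop_id, this, Finsupp.mapDomain_id]
  map_comp {R S T} f g := by
    apply AddCommGrpCat.hom_ext
    refine AddMonoidHom.ext fun (v : R.unop.Homs K →₀ ℤ) => ?_
    change Finsupp.mapDomain _ v = Finsupp.mapDomain _ (Finsupp.mapDomain _ v)
    have : OrbitCategory.Homs.precomp (K := K) (g.unop ≫ f.unop) =
        OrbitCategory.Homs.precomp g.unop ∘ OrbitCategory.Homs.precomp f.unop :=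
      funext (OrbitCategory.Homs.precomp_comp _ _)
    rw [unop_comp, this, Finsupp.mapDomain_comp]

variable {ι : Type u} (K : ι → OrbitCategory M)

/-- The basis elements of the values of a free Bredon module. -/
noncomputable def freeBasis {T : OrbitCategory M} (p : T.Homs K) : (free K).obj (op T) :=
  (Finsupp.single p 1 : T.Homs K →₀ ℤ)

/-- The generator `e_i` of the free Bredon module. -/
noncomputable def gen (i : ι) : (free K).obj (op (K i)) :=
  freeBasis K ⟨i, 𝟙 (K i)⟩

theorem free_map_basis {S T : OrbitCategory M} (f : S ⟶ T) (p : T.Homs K) :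
    (free K).map f.op (freeBasis K p) = freeBasis K (p.precomp f) :=
  Finsupp.mapDomain_single

theorem free_map_gen {T : OrbitCategory M} (i : ι) (f : T ⟶ K i) :
    (free K).map f.op (gen K i) = freeBasis K ⟨i, f⟩ := by
  rw [gen, free_map_basis, OrbitCategory.Homs.precomp, Category.comp_id]

/-- An additive subgroup of a value of the free module that contains all images of the generators
is everything. -/
theorem free_addSubgroup_eq_top {T : OrbitCategory M} (A : AddSubgroup ((free K).obj (op T)))
    (h : ∀ i (f : T ⟶ K i), (free K).map f.op (gen K i) ∈ A) : A = ⊤ := by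
  rw [eq_top_iff]
  intro v _
  refine Finsupp.induction_linear (motive := fun w : T.Homs K →₀ ℤ => Membership.mem A w) v
    A.zero_mem (fun a b => A.add_mem) ?_
  rintro ⟨i, f⟩ a
  have h1 := A.zsmul_mem (h i f) a
  rw [free_map_gen] at h1
  have h2 : (a • Finsupp.single (⟨i, f⟩ : T.Homs K) (1 : ℤ)) = Finsupp.single ⟨i, f⟩ a := by
    rw [Finsupp.smul_single, smul_eq_mul, mul_one]
  exact h2 ▸ h1

theorem free_hom_ext {V : BredonModule M} {f g : free K ⟶ V}
    (h : ∀ i, f.app (op (K i)) (gen K i) = g.app (op (K i)) (gen K i)) : f = g := by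
  apply NatTrans.ext
  funext T
  apply AddCommGrpCat.hom_ext
  refine AddMonoidHom.ext fun v => ?_
  have : (AddMonoidHom.eqLocus (f.app T).hom (g.app T).hom) = ⊤ := by
    refine free_addSubgroup_eq_top (T := T.unop) K _ fun i p => ?_
    have h1 := ConcreteCategory.congr_hom (f.naturality p.op) (gen K i)
    have h2 := ConcreteCategory.congr_hom (g.naturality p.op) (gen K i)
    refine h1.trans (Eq.trans ?_ h2.symm)
    exact congrArg (V.map p.op) (h i)
  have hv : v ∈ (AddMonoidHom.eqLocus (f.app T).hom (g.app T).hom) := by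
    rw [this]
    trivial
  exact hv

/-- The value of the morphism out of a free Bredon module given by the images of the generators. -/
noncomputable def liftApp (V : BredonModule M) (x : ∀ i, V.obj (op (K i))) (T : OrbitCategory M) :
    (T.Homs K →₀ ℤ) →+ V.obj (op T) :=
  Finsupp.liftAddHom (fun p : T.Homs K => (zmultiplesHom (V.obj (op T))) (V.map p.hom.op (x p.idx)))

theorem liftApp_single (V : BredonModule M) (x : ∀ i, V.obj (op (K i))) (T : OrbitCategory M)
    (p : T.Homs K) (a : ℤ) :
    liftApp K V x T (Finsupp.single p a) = a • V.map p.hom.op (x p.idx) := by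
  rw [liftApp, Finsupp.liftAddHom_apply_single, zmultiplesHom_apply]

/-- The morphism out of a free Bredon module given by the images of the generators. -/
noncomputable def lift (V : BredonModule M) (x : ∀ i, V.obj (op (K i))) : free K ⟶ V where
  app T := AddCommGrpCat.ofHom (liftApp K V x T.unop)
  naturality S T f := by
    apply AddCommGrpCat.hom_ext
    refine Finsupp.addHom_ext fun p a => ?_
    change liftApp K V x T.unop (Finsupp.mapDomain _ (Finsupp.single p a)) =
      V.map f (liftApp K V x S.unop (Finsupp.single p a))
    rw [Finsupp.mapDomain_single, liftApp_single, liftApp_single, map_zsmul]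
    congr 1
    change V.map (f.unop ≫ p.hom).op _ = _
    rw [op_comp, V.map_comp]
    rfl

theorem lift_gen (V : BredonModule M) (x : ∀ i, V.obj (op (K i))) (i : ι) :
    (lift K V x).app (op (K i)) (gen K i) = x i := by
  refine (liftApp_single K V x (K i) _ 1).trans ?_
  rw [one_smul, op_id, V.map_id]
  rfl

instance projective_free : Projective (free K) where
  factors {V W} f e _ := by
    have he : ∀ i, ∃ x : V.obj (op (K i)), e.app (op (K i)) x = f.app (op (K i)) (gen K i) :=
      fun i => evalMap_surjective e (K i) _
    choose x hx using he
    refine ⟨lift K V x, free_hom_ext K fun i => ?_⟩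
    rw [← hx i, ← lift_gen K V x i]
    rfl

/-- A Bredon submodule of `V` through which all generators pass gives a surjection from the
free module. -/
theorem lift_surjective (V : BredonModule M) (x : ∀ i, V.obj (op (K i)))
    (h : ∀ W : (∀ L : OrbitCategory M, AddSubgroup (V.obj (op L))),
      (∀ (L L' : OrbitCategory M) (f : L ⟶ L'), ∀ y ∈ W L', V.map f.op y ∈ W L) →
      (∀ i, x i ∈ W (K i)) → ∀ L, W L = ⊤) : Epi (lift K V x) := by
  refine epi_of_surjective _ fun T => ?_
  refine AddMonoidHom.range_eq_top.1 (h (fun L => ((lift K V x).app (op L)).hom.range) ?_ ?_ T)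
  · rintro L L' f _ ⟨y, rfl⟩
    exact ⟨(free K).map f.op y, ConcreteCategory.congr_hom ((lift K V x).naturality f.op) y⟩
  · exact fun i => ⟨gen K i, lift_gen K V x i⟩

instance enoughProjectives : EnoughProjectives (BredonModule M) where
  presentation V :=
    let K : (Σ T : OrbitCategory M, V.obj (op T)) → OrbitCategory M := fun p => p.1
    ⟨{  p := free K
        f := lift K V (fun p => p.2)
        projective := projective_free K
        epi := lift_surjective K V _ (by
          intro W _ hW L
          rw [eq_top_iff]
          exact fun v _ => hW ⟨L, v⟩) }⟩

theorem fg_of_finite {V : BredonModule M} {κ : Type*} [Finite κ] (L : κ → OrbitCategory M)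
    (x : ∀ i, V.obj (op (L i)))
    (h : ∀ W : (∀ L : OrbitCategory M, AddSubgroup (V.obj (op L))),
      (∀ (L L' : OrbitCategory M) (f : L ⟶ L'), ∀ y ∈ W L', V.map f.op y ∈ W L) →
      (∀ i, x i ∈ W (L i)) → ∀ L, W L = ⊤) : V.FG := by
  obtain ⟨r, ⟨e⟩⟩ := Finite.exists_equiv_fin κ
  refine ⟨r, fun j => L (e.symm j), fun j => x (e.symm j), fun W hW hx => h W hW fun i => ?_⟩
  have key : ∀ i', i' = i → x i' ∈ W (L i') → x i ∈ W (L i) := by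
    rintro _ rfl h
    exact h
  exact key _ (e.symm_apply_apply i) (hx (e i))

theorem free_fg [Finite ι] : (free K).FG :=
  fg_of_finite K (gen K) fun W hW hx L =>
    free_addSubgroup_eq_top K (W L) fun i f => hW L (K i) f _ (hx i)

theorem FG.exists_epi {V : BredonModule M} (h : V.FG) :
    ∃ (r : ℕ) (K : ULift.{u} (Fin r) → OrbitCategory M) (f : free K ⟶ V), Epi f := by
  obtain ⟨r, K, x, hx⟩ := h
  refine ⟨r, fun i => K i.down, lift _ V fun i => x i.down, lift_surjective _ V _ ?_⟩
  exact fun W hW hxW => hx W hW fun j => hxW ⟨j⟩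

theorem eval_free_fpn {T : OrbitCategory M} {k : ℕ}
    (h : FPn (MonoidAlgebra ℤ T.sub.normalizer) k (PermModule T.sub.normalizer (T.Homs K))) :
    FPn (MonoidAlgebra ℤ T.sub.normalizer) k ((free K).eval T) :=
  FPn.of_asModule_equiv (permRep T.sub.normalizer (T.Homs K)) ((free K).evalRep T)
    (AddEquiv.refl _) (fun _ _ => rfl) h

end BredonModule

end Bredon

/-! ### Bredon type `FP_n` in terms of normalizers -/

section BredonFP

open Opposite

variable {M : Type u} [Monoid M]

namespace BredonModule

theorem evalMap_comp {U V W : BredonModule M} (f : U ⟶ V) (g : V ⟶ W) (T : OrbitCategory M) :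
    evalMap (f ≫ g) T = evalMap g T ∘ₗ evalMap f T :=
  rfl

theorem evalMap_id (V : BredonModule M) (T : OrbitCategory M) :
    evalMap (𝟙 V) T = LinearMap.id :=
  rfl

/-- The values of finitely generated projective Bredon modules are of type `FP_k` for all `k` if
this holds for the values of the free modules of finite rank. -/
theorem eval_fpn_of_projective {V : BredonModule M} [Projective V] (hV : V.FG)
    (T : OrbitCategory M) {k : ℕ}
    (hA : ∀ (r : ℕ) (K : ULift.{u} (Fin r) → OrbitCategory M),
      FPn (MonoidAlgebra ℤ T.sub.normalizer) k (PermModule T.sub.normalizer (T.Homs K))) :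
    FPn (MonoidAlgebra ℤ T.sub.normalizer) k (V.eval T) := by
  obtain ⟨r, K, f, hf⟩ := hV.exists_epi
  refine FPn.of_retract (evalMap (Projective.factorThru (𝟙 V) f) T) (evalMap f T) ?_
    (eval_free_fpn K (hA r K))
  rw [← evalMap_comp, Projective.factorThru_comp, evalMap_id]

theorem eval_kernel_fpn {V W : BredonModule M} (f : V ⟶ W) [Epi f] (T : OrbitCategory M) {k : ℕ}
    (hV : FPn (MonoidAlgebra ℤ T.sub.normalizer) k (V.eval T))
    (hW : FPn (MonoidAlgebra ℤ T.sub.normalizer) (k + 1) (W.eval T)) :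
    FPn (MonoidAlgebra ℤ T.sub.normalizer) k ((Limits.kernel f).eval T) := by
  have h1 := FPn.kernel (evalMap f T) (evalMap_surjective f T) hV hW
  have h2 := evalMap_exact (ShortComplex.exact_kernel f) T
  have h3 := evalMap_injective (Limits.kernel.ι f) T
  refine FPn.of_equiv ((LinearEquiv.ofEq _ _ h2.linearMap_ker_eq).trans
    (LinearEquiv.ofInjective _ h3).symm) h1

theorem eval_trivial_fpn_iff (T : OrbitCategory M) {k : ℕ} :
    FPn (MonoidAlgebra ℤ T.sub.normalizer) k ((trivialBredonModule M).eval T) ↔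
      FPn (MonoidAlgebra ℤ T.sub.normalizer) k (TrivialModule T.sub.normalizer) :=
  ⟨FPn.of_asModule_equiv ((trivialBredonModule M).evalRep T)
    (Representation.trivial ℤ T.sub.normalizer (ULift.{u} ℤ)) (AddEquiv.refl (ULift.{u} ℤ))
    (fun _ _ => rfl),
  FPn.of_asModule_equiv (Representation.trivial ℤ T.sub.normalizer (ULift.{u} ℤ))
    ((trivialBredonModule M).evalRep T) (AddEquiv.refl (ULift.{u} ℤ)) (fun _ _ => rfl)⟩

/-- If all objects of the orbit category are isomorphic to one of finitely many, a Bredon module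
is finitely generated as soon as its values are, over the monoid rings of the normalizers. -/
theorem fg_of_eval {r : ℕ} (L : Fin r → OrbitCategory M)
    (hL : ∀ T : OrbitCategory M, ∃ j, Nonempty (T ≅ L j)) (V : BredonModule M)
    (hV : ∀ j, Module.Finite (MonoidAlgebra ℤ (L j).sub.normalizer) (V.eval (L j))) : V.FG := by
  choose s hs using fun j => (hV j).1
  refine fg_of_finite (κ := Σ j, s j) (fun p => L p.1) (fun p => p.2.1) fun W hW hx T => ?_
  -- `W` is stable under the normalizer of `L j`, and contains generators of the value at `L j`.
  have hWL : ∀ j, W (L j) = ⊤ := by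
    intro j
    let W' : Submodule (MonoidAlgebra ℤ (L j).sub.normalizer) (V.eval (L j)) :=
      { carrier := {v | (V.evalRep (L j)).asModuleEquiv v ∈ W (L j)}
        zero_mem' := (W (L j)).zero_mem
        add_mem' := (W (L j)).add_mem
        smul_mem' := by
          intro a v hv
          rw [Set.mem_ofPred_eq] at hv ⊢
          induction a using MonoidAlgebra.induction_linear with
          | zero =>
            rw [zero_smul]
            exact (W (L j)).zero_mem
          | add a b ha hb =>
            rw [add_smul]
            exact (W (L j)).add_mem ha hb
          | single n z =>
            rw [Representation.single_smul]
            exact (W (L j)).zsmul_mem (hW _ _ ((L j).endo n) _ hv) z }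
    have hW' : W' = ⊤ := by
      rw [eq_top_iff, ← hs j, Submodule.span_le]
      exact fun v hv => hx ⟨j, v, hv⟩
    rw [eq_top_iff]
    intro v _
    have : (V.evalRep (L j)).asModuleEquiv.symm v ∈ W' := by
      rw [hW']
      trivial
    exact this
  obtain ⟨j, ⟨e⟩⟩ := hL T
  rw [eq_top_iff]
  intro v _
  have h1 : V.map e.inv.op v ∈ W (L j) := by
    rw [hWL]
    trivial
  have h2 := hW T (L j) e.hom _ h1
  have h3 : V.map e.hom.op (V.map e.inv.op v) = v := by
    rw [← ConcreteCategory.comp_apply, ← V.map_comp, ← op_comp, e.hom_inv_id, op_id, V.map_id]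
    rfl
  rwa [h3] at h2

end BredonModule

open BredonModule

/-- If the trivial Bredon module is of type `FP_n`, so are the trivial modules of the
normalizers. -/
theorem BredonTypeFP.normalizer_fpn {n : ℕ∞} (h : BredonTypeFP n M)
    (hA : ∀ (T : OrbitCategory M) (r : ℕ) (K : ULift.{u} (Fin r) → OrbitCategory M) (k : ℕ),
      FPn (MonoidAlgebra ℤ T.sub.normalizer) k (PermModule T.sub.normalizer (T.Homs K)))
    (T : OrbitCategory M) (k : ℕ) (hk : (k : ℕ∞) ≤ n) :
    FPn (MonoidAlgebra ℤ T.sub.normalizer) k (TrivialModule T.sub.normalizer) := by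
  obtain ⟨P, hP⟩ := h
  rw [← eval_trivial_fpn_iff]
  refine FPn.of_resolution (fun i => BredonModule.eval (P.complex.X i) T)
    (fun i => evalMap (P.complex.d (i + 1) i) T) (evalMap (P.π.f 0) T) ?_ ?_ ?_ ?_
  · exact evalMap_surjective (P.π.f 0) T
  · exact evalMap_exact P.exact₀ T
  · exact fun i => evalMap_exact (P.exact_succ i) T
  · intro i hi
    exact eval_fpn_of_projective (hP i (le_trans (by exact_mod_cast hi) hk)) T
      fun r K => hA T r K _

/-- Conversely, the trivial Bredon module is of type `FP_n` if the trivial modules of the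
normalizers are, provided that the orbit category has finitely many isomorphism classes: the values
of the syzygies are then finitely generated, and so are the syzygies. -/
theorem bredonTypeFP_of_normalizer {n : ℕ∞}
    (hA : ∀ (T : OrbitCategory M) (r : ℕ) (K : ULift.{u} (Fin r) → OrbitCategory M) (k : ℕ),
      FPn (MonoidAlgebra ℤ T.sub.normalizer) k (PermModule T.sub.normalizer (T.Homs K)))
    {r : ℕ} (L : Fin r → OrbitCategory M) (hL : ∀ T : OrbitCategory M, ∃ j, Nonempty (T ≅ L j))
    (h : ∀ (T : OrbitCategory M) (k : ℕ), (k : ℕ∞) ≤ n →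
      FPn (MonoidAlgebra ℤ T.sub.normalizer) k (TrivialModule T.sub.normalizer)) :
    BredonTypeFP n M := by
  refine hasTypeFP_of_step _ n (fun k (V : BredonModule M) => ∀ j : ℕ, ((k + j : ℕ) : ℕ∞) ≤ n →
    ∀ T, FPn (MonoidAlgebra ℤ T.sub.normalizer) j (V.eval T)) ?_ _ ?_
  · intro k V hV
    by_cases hk : (k : ℕ∞) ≤ n
    · have hfg : V.FG := fg_of_eval L hL V fun j => hV 0 hk (L j)
      obtain ⟨r, K, f, hf⟩ := hfg.exists_epi
      refine ⟨free K, projective_free K, f, hf, fun _ => free_fg K, fun j hj T => ?_⟩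
      exact eval_kernel_fpn f T (eval_free_fpn K (hA T r K j))
        (hV (j + 1) (by rwa [show k + (j + 1) = k + 1 + j by omega]) T)
    -- Beyond degree `n`, any projective cover will do.
    · refine ⟨_, inferInstance, Projective.π V, inferInstance, fun h => absurd h hk, ?_⟩
      intro j hj
      exact absurd (le_trans (by exact_mod_cast (by omega : k ≤ k + 1 + j)) hj) hk
  · intro j hj T
    rw [eval_trivial_fpn_iff]
    exact h T j (by simpa using hj)

end BredonFP

/-! ### Finite subgroups of the monoid of a character -/

section CharacterMonoid

variable {G : Type u} [Group G] (χ : RealChar G)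

theorem RealChar.eq_one_of_mem_finite {K : Subgroup G} [Finite K] {k : G} (hk : k ∈ K) :
    χ k = 1 := by
  have h : IsOfFinOrder (⟨k, hk⟩ : K) := isOfFinOrder_of_finite _
  have h' := (χ.comp K.subtype).isOfFinOrder h
  exact (isOfFinOrder_iff_eq_one _).1 h'

theorem RealChar.mem_monoid_of_eq_one {g : G} (h : χ g = 1) : g ∈ χ.monoid := by
  rw [χ.mem_monoid, h, toAdd_one]

theorem RealChar.mem_monoid_of_eq {g h : G} (hg : g ∈ χ.monoid) (hgh : χ h = χ g) :
    h ∈ χ.monoid := by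
  rwa [χ.mem_monoid, hgh]

theorem RealChar.eq_one_of_unit (w : χ.monoidˣ) : χ (w : χ.monoid) = 1 := by
  have h1 : 0 ≤ (χ (w : χ.monoid)).toAdd := (w : χ.monoid).2
  have h2 : 0 ≤ (χ (↑w⁻¹ : χ.monoid)).toAdd := (↑w⁻¹ : χ.monoid).2
  have h3 : ((w : χ.monoid) : G) * ((↑w⁻¹ : χ.monoid) : G) = 1 := congrArg Subtype.val w.mul_inv
  have h4 := congrArg (fun g => (χ g).toAdd) h3
  simp only [map_mul, map_one, toAdd_mul, toAdd_one] at h4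
  exact Multiplicative.toAdd.injective (by rw [toAdd_one]; linarith)

/-- An element of the kernel of `χ`, as an invertible element of `G_χ`. -/
def RealChar.unit (g : G) (hg : χ g = 1) : χ.monoidˣ where
  val := ⟨g, χ.mem_monoid_of_eq_one hg⟩
  inv := ⟨g⁻¹, χ.mem_monoid_of_eq_one (by rw [map_inv, hg, inv_one])⟩
  val_inv := Subtype.ext (mul_inv_cancel g)
  inv_val := Subtype.ext (inv_mul_cancel g)

variable {χ}

/-- A finite subgroup of `G_χ`, as a subgroup of `G`. -/
def FiniteSubgroup.toSubgroup (K : FiniteSubgroup χ.monoid) : Subgroup G where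
  carrier := Subtype.val '' (K.toSubmonoid : Set χ.monoid)
  one_mem' := ⟨1, K.toSubmonoid.one_mem, rfl⟩
  mul_mem' := by
    rintro _ _ ⟨a, ha, rfl⟩ ⟨b, hb, rfl⟩
    exact ⟨a * b, K.toSubmonoid.mul_mem ha hb, rfl⟩
  inv_mem' := by
    rintro _ ⟨a, ha, rfl⟩
    obtain ⟨b, hb, hab, -⟩ := K.exists_inv' a ha
    exact ⟨b, hb, eq_inv_of_mul_eq_one_right (congrArg Subtype.val hab)⟩

instance FiniteSubgroup.finite_toSubgroup (K : FiniteSubgroup χ.monoid) : Finite K.toSubgroup :=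
  (K.finite'.image Subtype.val).to_subtype

theorem FiniteSubgroup.coe_mem_toSubgroup {K : FiniteSubgroup χ.monoid} {x : χ.monoid} :
    (x : G) ∈ K.toSubgroup ↔ x ∈ K.toSubmonoid := by
  constructor
  · rintro ⟨y, hy, hyx⟩
    rwa [← Subtype.ext hyx]
  · exact fun h => ⟨x, h, rfl⟩

variable (χ) in
/-- A finite subgroup of `G`, as a finite subgroup of `G_χ`. -/
def RealChar.finiteSubgroup (K : Subgroup G) [Finite K] : FiniteSubgroup χ.monoid where
  toSubmonoid := K.toSubmonoid.comap χ.monoid.subtype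
  finite' := Set.Finite.preimage Subtype.val_injective.injOn (Set.toFinite (K : Set G))
  exists_inv' := by
    intro x hx
    have hx' : (x : G) ∈ K := hx
    refine ⟨⟨(x : G)⁻¹, χ.mem_monoid_of_eq_one (χ.eq_one_of_mem_finite (K.inv_mem hx'))⟩,
      K.inv_mem hx', Subtype.ext (mul_inv_cancel _), Subtype.ext (inv_mul_cancel _)⟩

theorem RealChar.toSubgroup_finiteSubgroup (K : Subgroup G) [Finite K] :
    (χ.finiteSubgroup K).toSubgroup = K := by
  ext g
  constructor
  · rintro ⟨x, hx, rfl⟩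
    exact hx
  · exact fun hg => ⟨⟨g, χ.mem_monoid_of_eq_one (χ.eq_one_of_mem_finite hg)⟩, hg, rfl⟩

theorem Subgroup.mem_normalizer_of_finite {K : Subgroup G} [Finite K] {n : G}
    (h : ∀ k ∈ K, n⁻¹ * k * n ∈ K) : n ∈ Subgroup.normalizer (K : Set G) := by
  have h1 : n⁻¹ ∈ Subgroup.normalizer (K : Set G) := by
    have : Finite (K : Set G) := ‹Finite K›
    refine Subgroup.mem_normalizer_fintype fun k hk => ?_
    rw [inv_inv]
    exact h k hk
  simpa using Subgroup.inv_mem _ h1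

theorem FiniteSubgroup.exists_mul_iff {K L : FiniteSubgroup χ.monoid} {m : χ.monoid} :
    (∀ k ∈ K.toSubmonoid, ∃ l ∈ L.toSubmonoid, k * m = m * l) ↔
      ∀ k ∈ K.toSubgroup, (m : G)⁻¹ * k * m ∈ L.toSubgroup := by
  constructor
  · rintro h _ ⟨k, hk, rfl⟩
    obtain ⟨l, hl, hkl⟩ := h k hk
    have : (k : G) * m = m * l := congrArg Subtype.val hkl
    rw [mul_assoc, this, inv_mul_cancel_left]
    exact coe_mem_toSubgroup.2 hl
  · intro h k hk
    obtain ⟨l, hl, hkl⟩ := h k (coe_mem_toSubgroup.2 hk)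
    refine ⟨l, hl, Subtype.ext ?_⟩
    change (k : G) * m = m * l
    rw [hkl]
    group

theorem FiniteSubgroup.mem_normalizer_iff {K : FiniteSubgroup χ.monoid} {n : χ.monoid} :
    n ∈ K.normalizer ↔ (n : G) ∈ Subgroup.normalizer (K.toSubgroup : Set G) := by
  refine (FiniteSubgroup.exists_mul_iff (K := K) (L := K) (m := n)).trans ?_
  refine ⟨fun h => Subgroup.mem_normalizer_of_finite h, fun h k hk => ?_⟩
  exact (Subgroup.mem_normalizer_iff''.1 h k).1 hk

variable (χ) in
/-- The normalizers of the finite subgroups have the same image under `χ` as the whole group; in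
other words, `N(K) · ker χ = G` for all finite subgroups `K`. -/
def RealChar.NormalizersSurject : Prop :=
  ∀ K : Subgroup G, Finite K → ∀ g, ∃ n ∈ Subgroup.normalizer (K : Set G), χ n = χ g

/-- If `h⁻¹(gKg⁻¹)h = K` with `h` invertible, then `h⁻¹g` normalizes `K` and has the same value as
`g`. Conversely, `n⁻¹g` conjugates `H₁` to `g⁻¹H₁g = H₂` if `n` normalizes `H₁`, and is invertible
if `n` has the same value as `g`. -/
theorem RealChar.conjugatesFiniteSubgroups_iff :
    ConjugatesFiniteSubgroups χ.monoid ↔ χ.NormalizersSurject := by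
  constructor
  · intro h K _
    have key : ∀ g, 0 ≤ (χ g).toAdd → ∃ n ∈ Subgroup.normalizer (K : Set G), χ n = χ g := by
      intro g hg
      have _ : Finite (K.map (MulAut.conj g).toMonoidHom) :=
        (Set.toFinite ((MulAut.conj g).toMonoidHom '' (K : Set G))).to_subtype
      obtain ⟨w, hw⟩ := h (χ.finiteSubgroup (K.map (MulAut.conj g).toMonoidHom))
        (χ.finiteSubgroup K) ⟨g, hg⟩ (by
          ext x
          constructor
          · rintro ⟨a, ⟨k, hk, hka⟩, rfl⟩
            have hk1 := χ.eq_one_of_mem_finite (K := K) hk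
            refine ⟨⟨k, χ.mem_monoid_of_eq_one hk1⟩, hk, Subtype.ext ?_⟩
            change g * k = (a : G) * g
            have hka : g * k * g⁻¹ = a := hka
            rw [← hka, inv_mul_cancel_right]
          · rintro ⟨k, hk, rfl⟩
            have hk1 : χ (g * k * g⁻¹) = 1 := by
              rw [map_mul, map_mul, χ.eq_one_of_mem_finite (K := K) (k := k.1) hk, mul_one, map_inv,
                mul_inv_cancel]
            refine ⟨⟨g * k * g⁻¹, χ.mem_monoid_of_eq_one hk1⟩, ⟨k, hk, rfl⟩, Subtype.ext ?_⟩
            exact inv_mul_cancel_right (g * (k : G)) g)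
      have hw1 := χ.eq_one_of_unit w
      have hwinv : ((↑w⁻¹ : χ.monoid) : G) = ((w : χ.monoid) : G)⁻¹ :=
        eq_inv_of_mul_eq_one_right (congrArg Subtype.val w.mul_inv)
      refine ⟨((w : χ.monoid) : G)⁻¹ * g, ?_, by rw [map_mul, map_inv, hw1, inv_one, one_mul]⟩
      refine inv_inv (((w : χ.monoid) : G)⁻¹ * g) ▸ Subgroup.inv_mem _
        (Subgroup.mem_normalizer_of_finite fun k hk => ?_)
      have hk1 : χ (g * k * g⁻¹) = 1 := by
        rw [map_mul, map_mul, χ.eq_one_of_mem_finite hk, mul_one, map_inv, mul_inv_cancel]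
      have h1 : (↑w⁻¹ : χ.monoid) * ⟨g * k * g⁻¹, χ.mem_monoid_of_eq_one hk1⟩ * w ∈
          ((χ.finiteSubgroup K).toSubmonoid : Set χ.monoid) := by
        rw [← hw]
        exact ⟨_, ⟨k, hk, rfl⟩, rfl⟩
      have h2 : ((↑w⁻¹ : χ.monoid) : G) * (g * k * g⁻¹) * (w : χ.monoid) ∈ K := h1
      rw [hwinv] at h2
      convert h2 using 1
      group
    intro g
    rcases le_total 0 (χ g).toAdd with hg | hg
    · exact key g hg
    · obtain ⟨n, hn, hng⟩ := key g⁻¹ (by rw [map_inv, toAdd_inv]; linarith)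
      exact ⟨n⁻¹, Subgroup.inv_mem _ hn, by rw [map_inv, hng, map_inv, inv_inv]⟩
  · intro h H₁ H₂ g hg
    obtain ⟨n, hn, hng⟩ := h H₁.toSubgroup inferInstance g
    have hw : χ (n⁻¹ * g) = 1 := by rw [map_mul, map_inv, hng, inv_mul_cancel]
    refine ⟨χ.unit _ hw, ?_⟩
    have hsub := fun k hk => (Subgroup.mem_normalizer_iff.1 hn k).1 hk
    have hsub' := fun k hk => (Subgroup.mem_normalizer_iff''.1 hn k).1 hk
    ext x
    constructor
    · rintro ⟨a, ha, rfl⟩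
      obtain ⟨a', ha', haa'⟩ := hsub a (FiniteSubgroup.coe_mem_toSubgroup.2 ha)
      have h1 : a' * g ∈ (fun x => g * x) '' (H₂.toSubmonoid : Set χ.monoid) :=
        hg ▸ ⟨a', ha', rfl⟩
      obtain ⟨b, hb, hab⟩ := h1
      have hab' : (g : G) * b = a' * g := congrArg Subtype.val hab
      convert hb using 1
      apply Subtype.ext
      change (n⁻¹ * (g : G))⁻¹ * a * (n⁻¹ * g) = b
      rw [haa'] at hab'
      rw [← mul_right_inj (g : G), hab']
      group
    · intro hx
      have h1 : g * x ∈ (fun x => x * g) '' (H₁.toSubmonoid : Set χ.monoid) :=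
        hg ▸ ⟨x, hx, rfl⟩
      obtain ⟨a, ha, hax⟩ := h1
      have hax' : (a : G) * g = g * x := congrArg Subtype.val hax
      obtain ⟨b, hb, hba⟩ := hsub' a (FiniteSubgroup.coe_mem_toSubgroup.2 ha)
      refine ⟨b, hb, Subtype.ext ?_⟩
      change (n⁻¹ * (g : G))⁻¹ * b * (n⁻¹ * g) = x
      rw [hba, ← mul_right_inj (g : G), ← hax']
      group

end CharacterMonoid

/-! ### The orbit category of the monoid of a character -/

section CharacterOrbits

open Opposite

variable {G : Type u} [Group G] {χ : RealChar G}

namespace OrbitCategory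

/-- Finite subgroups that are conjugate under the kernel of the character give isomorphic orbits. -/
theorem nonempty_iso {T L : OrbitCategory χ.monoid} (h : G) (hh : χ h = 1)
    (hTL : ∀ g, g ∈ L.sub.toSubgroup ↔ h * g * h⁻¹ ∈ T.sub.toSubgroup) : Nonempty (T ≅ L) := by
  let w := χ.unit h hh
  have h1 : ∀ k ∈ T.sub.toSubmonoid, ∃ l ∈ L.sub.toSubmonoid,
      k * (w : χ.monoid) = (w : χ.monoid) * l := by
    rw [FiniteSubgroup.exists_mul_iff]
    intro k hk
    rw [hTL]
    change h * (h⁻¹ * k * h) * h⁻¹ ∈ _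
    convert hk using 1
    group
  have h2 : ∀ k ∈ L.sub.toSubmonoid, ∃ l ∈ T.sub.toSubmonoid,
      k * (↑w⁻¹ : χ.monoid) = (↑w⁻¹ : χ.monoid) * l := by
    rw [FiniteSubgroup.exists_mul_iff]
    intro k hk
    rw [hTL] at hk
    change (h⁻¹)⁻¹ * k * h⁻¹ ∈ _
    rwa [inv_inv]
  refine ⟨⟨T.sub.cosetMap L.sub _ h1, L.sub.cosetMap T.sub _ h2, ?_, ?_⟩⟩
  · refine FiniteSubgroup.cosets_hom_ext (congrArg T.sub.coset ?_)
    change 1 * (w : χ.monoid) * (↑w⁻¹ : χ.monoid) = 1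
    rw [mul_assoc, w.mul_inv, mul_one]
  · refine FiniteSubgroup.cosets_hom_ext (congrArg L.sub.coset ?_)
    change 1 * (↑w⁻¹ : χ.monoid) * (w : χ.monoid) = 1
    rw [mul_assoc, w.inv_mul, mul_one]

/-- If normalizers surject and every finite subgroup is subconjugate to one of finitely many by an
element of the monoid, the orbit category has finitely many isomorphism classes. -/
theorem exists_finite_representatives (hχ : χ.NormalizersSurject) {s : ℕ} (H : Fin s → Subgroup G)
    [∀ i, Finite (H i)]
    (hH : ∀ K : Subgroup G, Finite K → ∃ t i, ∀ k ∈ K, t⁻¹ * k * t ∈ H i) :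
    ∃ (r : ℕ) (L : Fin r → OrbitCategory χ.monoid),
      ∀ T : OrbitCategory χ.monoid, ∃ j, Nonempty (T ≅ L j) := by
  let S : Set (Subgroup G) := ⋃ i, {K | K ≤ H i}
  have hS : S.Finite := by
    refine Set.finite_iUnion fun i => ?_
    refine Set.Finite.of_finite_image (f := fun K : Subgroup G => (K : Set G)) ?_
      SetLike.coe_injective.injOn
    refine (Set.toFinite (H i : Set G)).finite_subsets.subset ?_
    rintro _ ⟨K, hK, rfl⟩
    exact hK
  have hS' : ∀ K : S, Finite K.1 := by
    rintro ⟨K, hK⟩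
    obtain ⟨i, hi⟩ := Set.mem_iUnion.1 hK
    exact Finite.of_injective _ (Subgroup.inclusion_injective hi)
  have := hS.to_subtype
  obtain ⟨r, ⟨e⟩⟩ := Finite.exists_equiv_fin S
  refine ⟨r, fun j => ⟨@RealChar.finiteSubgroup _ _ χ (e.symm j).1 (hS' _)⟩, fun T => ?_⟩
  obtain ⟨t, i, ht⟩ := hH T.sub.toSubgroup inferInstance
  -- The element `n⁻¹t` conjugates `T` to the same subgroup of `H i` as `t`, and lies in `ker χ`.
  obtain ⟨n, hn, hnt⟩ := hχ T.sub.toSubgroup inferInstance t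
  let K : Subgroup G := T.sub.toSubgroup.comap (MulAut.conj (n⁻¹ * t)).toMonoidHom
  have hmem : ∀ g, g ∈ K ↔ (n⁻¹ * t) * g * (n⁻¹ * t)⁻¹ ∈ T.sub.toSubgroup := fun g => Iff.rfl
  have hK : K ∈ S := by
    refine Set.mem_iUnion.2 ⟨i, fun g hg => ?_⟩
    have h1 := (Subgroup.mem_normalizer_iff.1 hn _).1 ((hmem g).1 hg)
    convert ht _ h1 using 1
    group
  refine ⟨e ⟨K, hK⟩, nonempty_iso (n⁻¹ * t) ?_ fun g => ?_⟩
  · rw [map_mul, map_inv, hnt, inv_mul_cancel]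
  · rw [RealChar.toSubgroup_finiteSubgroup, e.symm_apply_apply]
    exact hmem g

end OrbitCategory

/-- A set has finitely many classes if a finite-valued invariant separates them. -/
theorem Set.Finite.image_quotient_mk {X B : Type*} (s : Setoid X) {X₀ : Set X} (Φ : X → B)
    (hΦ : (Φ '' X₀).Finite) (h : ∀ p ∈ X₀, ∀ q ∈ X₀, Φ p = Φ q → s p q) :
    (Quotient.mk s '' X₀).Finite := by
  rcases isEmpty_or_nonempty X
  · exact Set.toFinite _
  · refine (hΦ.image fun b => Quotient.mk s (Function.invFunOn Φ X₀ b)).subset ?_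
    rintro _ ⟨p, hp, rfl⟩
    have hb : ∃ a ∈ X₀, Φ a = Φ p := ⟨p, hp, rfl⟩
    exact ⟨Φ p, ⟨p, hp, rfl⟩, Quotient.sound
      (h _ (Function.invFunOn_mem hb) _ hp (Function.invFunOn_eq hb))⟩

instance RealChar.isLeftCancelMul_submonoid (N : Submonoid χ.monoid) : IsLeftCancelMul N where
  mul_left_cancel _ _ _ h :=
    Subtype.ext (Subtype.ext (mul_left_cancel (congrArg (fun x : N => (x.1 : G)) h)))

namespace OrbitCategory

/-- The image of the coset of `1` under a morphism, which determines the morphism. -/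
def base {M : Type u} [Monoid M] {S T : OrbitCategory M} (f : S ⟶ T) : T.sub.Cosets :=
  (show S.sub.Cosets →[M] T.sub.Cosets from f) (S.sub.coset 1)

variable {M ι : Type u} [Monoid M] {T : OrbitCategory M} {K : ι → OrbitCategory M}

theorem Homs.coset_smul (n : T.sub.normalizer) {p : T.Homs K} {m : M}
    (hm : (K p.idx).sub.coset m = base p.hom) :
    (K (n • p).idx).sub.coset (n.1 * m) = base (n • p).hom := by
  let f : T.sub.Cosets →[M] (K p.idx).sub.Cosets := p.hom
  change (K p.idx).sub.coset (n.1 * m) = f (T.sub.coset (1 * n.1))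
  rw [one_mul, ← mul_one n.1, ← FiniteSubgroup.smul_coset T.sub, map_smul, mul_one,
    ← FiniteSubgroup.smul_coset, hm]
  rfl

theorem Homs.eq_iff {p q : T.Homs K} {a b : M} (ha : (K p.idx).sub.coset a = base p.hom)
    (hb : (K q.idx).sub.coset b = base q.hom) :
    p = q ↔ p.idx = q.idx ∧ ∃ l ∈ (K p.idx).sub.toSubmonoid, a * l = b := by
  constructor
  · rintro rfl
    exact ⟨rfl, (FiniteSubgroup.coset_eq_iff _).1 (ha.trans hb.symm)⟩
  · obtain ⟨i, f⟩ := p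
    obtain ⟨j, g⟩ := q
    rintro ⟨rfl : i = j, h⟩
    exact congrArg _ (FiniteSubgroup.cosets_hom_ext
      (ha.symm.trans (((FiniteSubgroup.coset_eq_iff _).2 h).trans hb)))

end OrbitCategory

open OrbitCategory in
/-- If normalizers surject, the sets of morphisms of the orbit category satisfy the conditions of
`PermModule.fpn_of_orbits`, with the morphisms given by elements of the kernel of the character
as the distinguished points. -/
theorem RealChar.NormalizersSurject.fpn_permModule_homs (hχ : χ.NormalizersSurject)
    (T : OrbitCategory χ.monoid) (r : ℕ) (K : ULift.{u} (Fin r) → OrbitCategory χ.monoid) (k : ℕ) :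
    FPn (MonoidAlgebra ℤ T.sub.normalizer) k (PermModule T.sub.normalizer (T.Homs K)) := by
  have hm : ∀ p : T.Homs K, ∃ m : χ.monoid, (K p.idx).sub.coset m = base p.hom :=
    fun p => FiniteSubgroup.exists_coset _ _
  choose m hm using hm
  have hmK : ∀ (p : T.Homs K), ∀ g ∈ T.sub.toSubgroup,
      (m p : G)⁻¹ * g * m p ∈ (K p.idx).sub.toSubgroup := fun p =>
    FiniteSubgroup.exists_mul_iff.1 (FiniteSubgroup.mul_of_hom p.hom (hm p).symm)
  have hK1 : ∀ {i} {l : χ.monoid}, l ∈ (K i).sub.toSubmonoid → χ l = 1 := fun hl =>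
    χ.eq_one_of_mem_finite (FiniteSubgroup.coe_mem_toSubgroup.2 hl)
  let unit : ∀ g ∈ Subgroup.normalizer (T.sub.toSubgroup : Set G), χ g = 1 → T.sub.normalizerˣ :=
    fun g hg hg1 =>
      { val := ⟨(χ.unit g hg1 : χ.monoid), FiniteSubgroup.mem_normalizer_iff.2 hg⟩
        inv := ⟨(↑(χ.unit g hg1)⁻¹ : χ.monoid),
          FiniteSubgroup.mem_normalizer_iff.2 (Subgroup.inv_mem _ hg)⟩
        val_inv := Subtype.ext (χ.unit g hg1).mul_inv
        inv_val := Subtype.ext (χ.unit g hg1).inv_mul }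
  have hnorm : ∀ n : T.sub.normalizer,
      (n.1 : G) ∈ Subgroup.normalizer (T.sub.toSubgroup : Set G) :=
    fun n => FiniteSubgroup.mem_normalizer_iff.1 n.2
  refine PermModule.fpn_of_orbits {p | χ (m p) = 1} ?_ ?_ ?_ ?_ k
  · intro p
    obtain ⟨n, hn, hnm⟩ := hχ T.sub.toSubgroup inferInstance (m p)
    -- The morphism given by `m` is that given by `n⁻¹m ∈ ker χ`, translated by `n`.
    have hw : χ (n⁻¹ * m p) = 1 := by rw [map_mul, map_inv, hnm, inv_mul_cancel]
    have hn0 : n ∈ χ.monoid := χ.mem_monoid_of_eq (m p).2 hnm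
    have hmor : ∀ k ∈ T.sub.toSubmonoid, ∃ l ∈ (K p.idx).sub.toSubmonoid,
        k * (χ.unit _ hw : χ.monoid) = (χ.unit _ hw : χ.monoid) * l := by
      rw [FiniteSubgroup.exists_mul_iff]
      intro g hg
      have := hmK p _ ((Subgroup.mem_normalizer_iff.1 hn g).1 hg)
      convert this using 1
      change (n⁻¹ * (m p : G))⁻¹ * g * (n⁻¹ * m p) = _
      group
    let q : T.Homs K := ⟨p.idx, T.sub.cosetMap (K p.idx).sub _ hmor⟩
    have hq : (K q.idx).sub.coset (χ.unit _ hw : χ.monoid) = base q.hom :=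
      congrArg (K p.idx).sub.coset (one_mul _).symm
    obtain ⟨-, l, hl, hql⟩ := (Homs.eq_iff hq (hm q)).1 rfl
    refine ⟨q, ?_, ⟨⟨n, hn0⟩, FiniteSubgroup.mem_normalizer_iff.2 hn⟩, ?_⟩
    · change χ (m q) = 1
      rw [← hql]
      exact (map_mul χ _ _).trans (by rw [hK1 hl, mul_one]; exact hw)
    · refine (Homs.eq_iff (Homs.coset_smul _ hq) (hm p)).2
        ⟨rfl, 1, Submonoid.one_mem _, Subtype.ext ?_⟩
      change n * (n⁻¹ * m p) * 1 = (m p : G)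
      group
  · intro p (hp : χ (m p : G) = 1) q (hq : χ (m q : G) = 1) n n' hnn'
    obtain ⟨hi, l, hl, h⟩ := (Homs.eq_iff (Homs.coset_smul n (hm p))
      (Homs.coset_smul n' (hm q))).1 hnn'
    have h' : (n.1 : G) * m p * l = n'.1 * m q := congrArg Subtype.val h
    have hw : χ ((n'.1 : G)⁻¹ * n.1) = 1 := by
      have := congrArg χ h'
      rw [map_mul, map_mul, map_mul, hK1 hl, hp, hq, mul_one, mul_one,
        mul_one] at this
      rw [map_mul, map_inv, this, inv_mul_cancel]
    let w := unit _ (Subgroup.mul_mem _ (Subgroup.inv_mem _ (hnorm n')) (hnorm n)) hw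
    refine ⟨w, ((Homs.eq_iff (Homs.coset_smul w.1 (hm p)) (hm q)).2
      ⟨hi, l, hl, Subtype.ext ?_⟩).symm, Subtype.ext (Subtype.ext ?_)⟩
    · change (n'.1 : G)⁻¹ * n.1 * m p * l = m q
      rw [← mul_right_inj (n'.1 : G), ← h']
      group
    · change (n.1 : G) = n'.1 * ((n'.1 : G)⁻¹ * n.1)
      group
  -- The orbit of a morphism `xT ↦ xmK_i` depends only on `i` and the subgroup `m⁻¹Tm` of `K_i`.
  · let Φ : T.Homs K → ULift.{u} (Fin r) × Set G := fun p =>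
      (p.idx, (fun g => (m p : G)⁻¹ * g * m p) '' T.sub.toSubgroup)
    refine Set.Finite.image_quotient_mk _ Φ ?_ ?_
    · refine Set.Finite.subset (s := ⋃ i, {i} ×ˢ {A : Set G | A ⊆ (K i).sub.toSubgroup}) ?_ ?_
      · exact Set.finite_iUnion fun i => (Set.finite_singleton i).prod
          ((K i).sub.finite'.image Subtype.val).finite_subsets
      · rintro _ ⟨p, -, rfl⟩
        refine Set.mem_iUnion.2 ⟨p.idx, rfl, ?_⟩
        rintro _ ⟨g, hg, rfl⟩
        exact hmK p g hg
    · intro p (hp : χ (m p : G) = 1) q (hq : χ (m q : G) = 1) hpq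
      have hi : p.idx = q.idx := congrArg Prod.fst hpq
      have hpq' : (fun g => (m p : G)⁻¹ * g * m p) '' (T.sub.toSubgroup : Set G) =
        (fun g => (m q : G)⁻¹ * g * m q) '' T.sub.toSubgroup := congrArg Prod.snd hpq
      have hw : χ ((m p : G) * (m q : G)⁻¹) = 1 := by
        rw [map_mul, map_inv, hp, hq, inv_one, one_mul]
      have hn : (m p : G) * (m q : G)⁻¹ ∈ Subgroup.normalizer (T.sub.toSubgroup : Set G) := by
        refine Subgroup.mem_normalizer_of_finite fun g hg => ?_
        have h1 : (m p : G)⁻¹ * g * m p ∈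
            (fun g => (m q : G)⁻¹ * g * m q) '' (T.sub.toSubgroup : Set G) := hpq' ▸ ⟨g, hg, rfl⟩
        obtain ⟨g', hg', h2⟩ := h1
        have h2 : (m q : G)⁻¹ * g' * m q = (m p : G)⁻¹ * g * m p := h2
        have h3 : ((m p : G) * (m q : G)⁻¹)⁻¹ * g * ((m p : G) * (m q : G)⁻¹) =
            m q * ((m p : G)⁻¹ * g * m p) * (m q : G)⁻¹ := by group
        rw [h3, ← h2]
        have h4 : (m q : G) * ((m q : G)⁻¹ * g' * m q) * (m q : G)⁻¹ = g' := by group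
        rwa [h4]
      rw [MulAction.orbitRel_apply]
      refine ⟨unit _ hn hw, (Homs.eq_iff (Homs.coset_smul (unit _ hn hw).1 (hm q)) (hm p)).2
        ⟨hi.symm, 1, Submonoid.one_mem _, Subtype.ext ?_⟩⟩
      change (m p : G) * (m q : G)⁻¹ * m q * 1 = m p
      group
  · intro p _
    have hw : ∀ w : MulAction.stabilizer T.sub.normalizerˣ p,
        (m p : G)⁻¹ * (w.1.1.1 : G) * m p ∈ (K p.idx).sub.toSubgroup := by
      intro w
      obtain ⟨-, l, hl, h⟩ := (Homs.eq_iff (hm p) (Homs.coset_smul w.1.1 (hm p))).1 w.2.symm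
      have h' : (m p : G) * l = w.1.1.1 * m p := congrArg Subtype.val h
      rw [mul_assoc, ← h', inv_mul_cancel_left]
      exact FiniteSubgroup.coe_mem_toSubgroup.2 hl
    refine Finite.of_injective (β := (K p.idx).sub.toSubgroup) (fun w => ⟨_, hw w⟩) ?_
    intro w w' h
    have h1 : (m p : G)⁻¹ * (w.1.1.1 : G) * m p = (m p : G)⁻¹ * (w'.1.1.1 : G) * m p :=
      congrArg Subtype.val h
    exact Subtype.ext (Units.ext (Subtype.ext (Subtype.ext
      (mul_left_cancel (mul_right_cancel h1)))))

end CharacterOrbits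

/-! ### The Bredon invariant in terms of normalizers of finite subgroups -/

section Sigma

theorem FPn.trivialModule_congr {N M : Type u} [Monoid N] [Monoid M] (e : N ≃* M) {k : ℕ}
    (h : FPn (MonoidAlgebra ℤ N) k (TrivialModule N)) :
    FPn (MonoidAlgebra ℤ M) k (TrivialModule M) := by
  let f := MonoidAlgebra.mapDomainRingHom ℤ e.toMonoidHom
  let g := MonoidAlgebra.mapDomainRingHom ℤ e.symm.toMonoidHom
  have hfg : ∀ r, f (g r) = r := by
    intro r
    induction r using MonoidAlgebra.induction_linear with
    | zero => simp
    | add r s hr hs => rw [map_add, map_add, hr, hs]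
    | single m a => simp [f, g]
  have hgf : ∀ r, g (f r) = r := by
    intro r
    induction r using MonoidAlgebra.induction_linear with
    | zero => simp
    | add r s hr hs => rw [map_add, map_add, hr, hs]
    | single m a => simp [f, g]
  have haug : ∀ r, augmentation M (f r) = augmentation N r := by
    intro r
    induction r using MonoidAlgebra.induction_linear with
    | zero => simp
    | add r s hr hs => rw [map_add, map_add, map_add, hr, hs]
    | single m a => simp [f, augmentation_single]
  have hf : f.LocallyFree := fun s x => ⟨PUnit, inferInstance, fun _ => 1, fun _ i => g (x i), by
    simp [hfg], fun z hz => by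
      funext i
      have := congrArg g hz
      simpa [hgf] using this⟩
  refine extendScalars_cyclic hf _ _ TrivialModule.exists_smul_one
    TrivialModule.exists_smul_one ?_ ?_ h
  · intro s hs
    rwa [TrivialModule.smul_one_eq_zero_iff, haug, ← TrivialModule.smul_one_eq_zero_iff]
  · intro r hr
    refine Submodule.subset_span ⟨g r, ?_, hfg r⟩
    rwa [Set.mem_ofPred_eq, TrivialModule.smul_one_eq_zero_iff, ← haug, hfg,
      ← TrivialModule.smul_one_eq_zero_iff]

theorem monoidTypeFP_iff {n : ℕ∞} {M : Type u} [Monoid M] :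
    MonoidTypeFP n M ↔
      ∀ k : ℕ, (k : ℕ∞) ≤ n → FPn (MonoidAlgebra ℤ M) k (TrivialModule M) :=
  moduleCat_hasTypeFP_iff n (trivialMonoidModule M)

/-- If the trivial Bredon module is the image of a finitely generated one, every object of the orbit
category has a morphism to one of finitely many. -/
theorem BredonTypeFP.exists_hom {n : ℕ∞} {M : Type u} [Monoid M] (h : BredonTypeFP n M) :
    ∃ (r : ℕ) (L : Fin r → OrbitCategory M), ∀ T, ∃ j, Nonempty (T ⟶ L j) := by
  obtain ⟨P, hP⟩ := h
  obtain ⟨r, K, f, hf⟩ := (hP 0 (by simp)).exists_epi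
  refine ⟨r, fun j => K ⟨j⟩, fun T => ?_⟩
  by_contra! hT
  -- The value of `free K` at `T` would be zero, but it maps onto `ℤ`.
  have : IsEmpty (T.Homs K) := ⟨fun p => (hT p.idx.down).false p.hom⟩
  obtain ⟨x, hx⟩ := BredonModule.evalMap_surjective (P.π.f 0) T
    (ULift.up 1 : ULift.{u} ℤ)
  obtain ⟨y, rfl⟩ := BredonModule.evalMap_surjective f T x
  have hy : y = 0 := Subsingleton.elim (α := T.Homs K →₀ ℤ) y 0
  rw [hy, map_zero, map_zero] at hx
  exact zero_ne_one (congrArg ULift.down (show (0 : ULift.{u} ℤ) = ULift.up 1 from hx))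

variable {G : Type u} [Group G] {χ : RealChar G}

/-- The normalizer of a finite subgroup in the monoid `G_χ` is the monoid of the restriction of `χ`
to its normalizer in `G`. -/
def FiniteSubgroup.normalizerEquiv (L : FiniteSubgroup χ.monoid) {K : Subgroup G}
    (h : L.toSubgroup = K) :
    L.normalizer ≃* (χ.res (Subgroup.normalizer (K : Set G))).monoid where
  toFun n := ⟨⟨n.1.1, h ▸ FiniteSubgroup.mem_normalizer_iff.1 n.2⟩, n.1.2⟩
  invFun n := ⟨⟨n.1.1, n.2⟩, FiniteSubgroup.mem_normalizer_iff.2 (h ▸ n.1.2)⟩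
  left_inv _ := rfl
  right_inv _ := rfl
  map_mul' _ _ := rfl

/-- The Bredon type of `G_χ`, for a character for which `G_χ` conjugates finite subgroups. -/
theorem RealChar.NormalizersSurject.bredonTypeFP_iff (hχ : χ.NormalizersSurject) {n : ℕ∞} :
    BredonTypeFP n χ.monoid ↔
      (∀ K : Subgroup G, Finite K →
        MonoidTypeFP n (χ.res (Subgroup.normalizer (K : Set G))).monoid) ∧
      ∃ (s : ℕ) (H : Fin s → Subgroup G), (∀ i, Finite (H i)) ∧
        ∀ K : Subgroup G, Finite K →
          ∃ t, 0 ≤ (χ t).toAdd ∧ ∃ i, ∀ k ∈ K, t⁻¹ * k * t ∈ H i := by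
  constructor
  · intro h
    refine ⟨fun K _ => monoidTypeFP_iff.2 fun k hk => ?_, ?_⟩
    · exact FPn.trivialModule_congr
        ((χ.finiteSubgroup K).normalizerEquiv (χ.toSubgroup_finiteSubgroup K))
        (h.normalizer_fpn hχ.fpn_permModule_homs ⟨χ.finiteSubgroup K⟩ k hk)
    · obtain ⟨r, L, hL⟩ := h.exists_hom
      refine ⟨r, fun j => (L j).sub.toSubgroup, fun j => inferInstance, fun K _ => ?_⟩
      obtain ⟨j, ⟨f⟩⟩ := hL ⟨χ.finiteSubgroup K⟩
      obtain ⟨t, ht⟩ := (L j).sub.exists_coset (OrbitCategory.base f)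
      have h1 := FiniteSubgroup.exists_mul_iff.1 (FiniteSubgroup.mul_of_hom f ht.symm)
      rw [RealChar.toSubgroup_finiteSubgroup] at h1
      exact ⟨t, t.2, j, h1⟩
  · rintro ⟨h, s, H, hH, hK⟩
    obtain ⟨r, L, hL⟩ := OrbitCategory.exists_finite_representatives hχ H
      fun K hK' => (hK K hK').imp fun _ h => h.2
    exact bredonTypeFP_of_normalizer hχ.fpn_permModule_homs L hL fun T k hk =>
      FPn.trivialModule_congr (T.sub.normalizerEquiv rfl).symm
        (monoidTypeFP_iff.1 (h T.sub.toSubgroup inferInstance) k hk)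

end Sigma

/-! ### Passage to a subgroup of finite index -/

section Transfer

variable {G : Type u} [Group G] {χ : RealChar G}

/-- The monoids of a character and of its restrictions depend only on its class. -/
theorem CharSphere.monoid_eq_of_mk_eq {χ' : RealChar G} {hχ : χ ≠ 1} {hχ' : χ' ≠ 1}
    (h : CharSphere.mk χ hχ = CharSphere.mk χ' hχ') : χ.monoid = χ'.monoid ∧
      ∀ H : Subgroup G, (χ.res H).monoid = (χ'.res H).monoid := by
  obtain ⟨r, hr, h⟩ := Quotient.exact h
  have key : ∀ g, 0 ≤ (χ g).toAdd ↔ 0 ≤ (χ' g).toAdd := fun g => by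
    rw [h g, mul_nonneg_iff_of_pos_left hr]
  exact ⟨Submonoid.ext key, fun H => Submonoid.ext fun g => key g⟩

theorem mk_mem_sigmaInv_iff (hχ : χ ≠ 1) {n : ℕ∞} :
    CharSphere.mk χ hχ ∈ SigmaInv n G ↔ MonoidTypeFP n χ.monoid := by
  constructor
  · rintro ⟨χ', hχ', h, h'⟩
    rwa [(CharSphere.monoid_eq_of_mk_eq h).1]
  · exact fun h => ⟨χ, hχ, rfl, h⟩

theorem mk_mem_bredonSigma_iff (hχ : χ ≠ 1) {n : ℕ∞} :
    CharSphere.mk χ hχ ∈ BredonSigma n G ↔ ∃ Gt : Subgroup G, Gt.FiniteIndex ∧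
      commutator G ≤ Gt ∧ (∀ K : Subgroup G, Finite K → K ≤ Gt) ∧
      ConjugatesFiniteSubgroups (χ.res Gt).monoid ∧ BredonTypeFP n (χ.res Gt).monoid := by
  constructor
  · rintro ⟨χ', hχ', h, Gt, h1, h2, h3, h4⟩
    exact ⟨Gt, h1, h2, h3, by rwa [(CharSphere.monoid_eq_of_mk_eq h).2]⟩
  · exact fun h => ⟨χ, hχ, rfl, h⟩

variable {Gt : Subgroup G}

theorem forall_finite_subgroupOf (hGt : ∀ K : Subgroup G, Finite K → K ≤ Gt)
    (P : Subgroup Gt → Prop) :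
    (∀ K : Subgroup Gt, Finite K → P K) ↔ ∀ K : Subgroup G, Finite K → P (K.subgroupOf Gt) := by
  constructor
  · intro h K _
    exact h _ (Finite.of_injective _ (Subgroup.subgroupOfEquivOfLe (hGt K ‹_›)).injective)
  · intro h K _
    have := h (K.map Gt.subtype) (Set.toFinite (Gt.subtype '' (K : Set Gt))).to_subtype
    rwa [Subgroup.subgroupOf, Subgroup.comap_map_eq_self_of_injective Gt.subtype_injective] at this

theorem mem_normalizer_subgroupOf {K : Subgroup G} (hK : K ≤ Gt) {g : Gt} :
    g ∈ Subgroup.normalizer (K.subgroupOf Gt : Set Gt) ↔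
      (g : G) ∈ Subgroup.normalizer (K : Set G) := by
  rw [← Subgroup.subgroupOf_normalizer_eq hK, Subgroup.mem_subgroupOf]

theorem normalizer_mul_ker_eq_iff (K : Subgroup G) :
    ((Subgroup.normalizer (K : Set G) ⊓ Gt : Subgroup G) : Set G) *
        ((χ.ker ⊓ Gt : Subgroup G) : Set G) = (Gt : Set G) ↔
      ∀ g ∈ Gt, ∃ n ∈ Subgroup.normalizer (K : Set G) ⊓ Gt, χ n = χ g := by
  constructor
  · intro h g hg
    rw [← SetLike.mem_coe, ← h] at hg
    obtain ⟨n, hn, k, hk, rfl⟩ := hg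
    have hk : χ k = 1 := hk.1
    exact ⟨n, hn, by rw [map_mul, hk, mul_one]⟩
  · intro h
    apply Set.Subset.antisymm
    · rintro _ ⟨n, hn, k, hk, rfl⟩
      exact Gt.mul_mem hn.2 hk.2
    · intro g hg
      obtain ⟨n, hn, hng⟩ := h g hg
      refine ⟨n, hn, n⁻¹ * g, ⟨?_, Gt.mul_mem (Gt.inv_mem hn.2) hg⟩, mul_inv_cancel_left n g⟩
      change χ (n⁻¹ * g) = 1
      rw [map_mul, map_inv, hng, inv_mul_cancel]

theorem normalizersSurject_res_iff (hGt : ∀ K : Subgroup G, Finite K → K ≤ Gt) :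
    (χ.res Gt).NormalizersSurject ↔ ∀ K : Subgroup G, Finite K →
      ((Subgroup.normalizer (K : Set G) ⊓ Gt : Subgroup G) : Set G) *
        ((χ.ker ⊓ Gt : Subgroup G) : Set G) = (Gt : Set G) := by
  refine (forall_finite_subgroupOf hGt _).trans ?_
  refine forall₂_congr fun K hK => ?_
  rw [normalizer_mul_ker_eq_iff]
  constructor
  · intro h g hg
    obtain ⟨n, hn, hng⟩ := h ⟨g, hg⟩
    exact ⟨n, ⟨(mem_normalizer_subgroupOf (hGt K hK)).1 hn, n.2⟩, hng⟩
  · rintro h ⟨g, hg⟩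
    obtain ⟨n, hn, hng⟩ := h g hg
    exact ⟨⟨n, hn.2⟩, (mem_normalizer_subgroupOf (hGt K hK)).2 hn.1, hng⟩

theorem res_normalizer_ne_one (hχ : χ ≠ 1) [Gt.FiniteIndex] {K : Subgroup G}
    (h : ∀ g ∈ Gt, ∃ n ∈ Subgroup.normalizer (K : Set G) ⊓ Gt, χ n = χ g) :
    χ.res (Subgroup.normalizer (K : Set G)) ≠ 1 := by
  intro h1
  obtain ⟨t, ht, htχ⟩ := χ.exists_pos Gt hχ
  obtain ⟨n, hn, hnt⟩ := h t ht
  have h2 : χ n = 1 := DFunLike.congr_fun h1 (⟨n, hn.1⟩ : Subgroup.normalizer (K : Set G))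
  rw [← hnt, h2, toAdd_one] at htχ
  exact lt_irrefl _ htχ

/-- The normalizer of a subgroup `K ≤ Gt` in `Gt` can be replaced by the one in `G`. -/
theorem monoidTypeFP_normalizer_subgroupOf_iff [Gt.FiniteIndex] [Gt.Normal] {K : Subgroup G}
    (hK : K ≤ Gt) (h : χ.res (Subgroup.normalizer (K : Set G)) ≠ 1) {n : ℕ∞} :
    MonoidTypeFP n
        ((χ.res Gt).res (Subgroup.normalizer (K.subgroupOf Gt : Set Gt))).monoid ↔
      MonoidTypeFP n (χ.res (Subgroup.normalizer (K : Set G))).monoid := by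
  let e : ((χ.res Gt).res (Subgroup.normalizer (K.subgroupOf Gt : Set Gt))).monoid ≃*
      ((χ.res (Subgroup.normalizer (K : Set G))).res
        (Gt.subgroupOf (Subgroup.normalizer (K : Set G)))).monoid :=
    { toFun := fun n => ⟨⟨⟨n.1.1.1, (mem_normalizer_subgroupOf hK).1 n.1.2⟩, n.1.1.2⟩, n.2⟩
      invFun := fun n => ⟨⟨⟨n.1.1.1, n.1.2⟩, (mem_normalizer_subgroupOf hK).2 n.1.1.2⟩, n.2⟩
      left_inv := fun _ => rfl
      right_inv := fun _ => rfl
      map_mul' := fun _ _ => rfl }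
  rw [monoidTypeFP_iff, monoidTypeFP_iff]
  refine forall₂_congr fun k _ => ⟨fun hk => ?_, fun hk => ?_⟩
  · exact RealChar.fpn_of_res _ _ (FPn.trivialModule_congr e hk)
  · exact FPn.trivialModule_congr e.symm (RealChar.fpn_res _ _ h hk)

theorem mul_singleton_subset_iff {K H : Subgroup G} {m : G} :
    (K : Set G) * {m} ⊆ {m} * (H : Set G) ↔ ∀ k ∈ K, m⁻¹ * k * m ∈ H := by
  rw [Set.mul_singleton, Set.singleton_mul, Set.image_subset_iff]
  refine forall₂_congr fun k _ => ?_
  rw [Set.mem_preimage, Set.mem_image]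
  constructor
  · rintro ⟨l, hl, hlk⟩
    rw [mul_assoc, ← hlk, inv_mul_cancel_left]
    exact hl
  · exact fun h => ⟨_, h, by group⟩

end Transfer

theorem mainTheorem5 {G : Type u} [Group G] [Group.FG G] (χ : RealChar G) (hχ : χ ≠ 1) (n : ℕ∞) :
    CharSphere.mk χ hχ ∈ BredonSigma n G ↔
      ∃ (Gt : Subgroup G) (s : ℕ) (H : Fin s → Subgroup G),
        Gt.FiniteIndex ∧ commutator G ≤ Gt ∧ (∀ i, H i ≤ Gt ∧ Finite (H i)) ∧
        ∀ K : Subgroup G, Finite K →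
          K ≤ Gt ∧
          ((Subgroup.normalizer (K : Set G) ⊓ Gt : Subgroup G) : Set G) *
              ((χ.ker ⊓ Gt : Subgroup G) : Set G) = (Gt : Set G) ∧
          (∃ hK : χ.res (Subgroup.normalizer (K : Set G)) ≠ 1,
            CharSphere.mk (χ.res (Subgroup.normalizer (K : Set G))) hK ∈
              SigmaInv n (Subgroup.normalizer (K : Set G))) ∧
          ∃ m ∈ Gt, 0 ≤ (χ m).toAdd ∧
            ∃ i, (K : Set G) * {m} ⊆ {m} * (H i : Set G) := by
  rw [mk_mem_bredonSigma_iff]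
  constructor
  · rintro ⟨Gt, hfin, hcomm, hGt, hconj, hFP⟩
    have := Subgroup.Normal.of_commutator_le _ hcomm
    have h1 := RealChar.conjugatesFiniteSubgroups_iff.1 hconj
    obtain ⟨h2, s, H, hH, h3⟩ := h1.bredonTypeFP_iff.1 hFP
    rw [normalizersSurject_res_iff hGt] at h1
    rw [forall_finite_subgroupOf hGt] at h2 h3
    refine ⟨Gt, s, fun i => (H i).map Gt.subtype, hfin, hcomm, fun i =>
      ⟨Subgroup.map_subtype_le _, ?_⟩, fun K hK => ⟨hGt K hK, h1 K hK, ?_, ?_⟩⟩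
    · have := hH i
      exact (Set.toFinite (Gt.subtype '' (H i : Set Gt))).to_subtype
    · have hne := res_normalizer_ne_one hχ ((normalizer_mul_ker_eq_iff K).1 (h1 K hK))
      refine ⟨hne, (mk_mem_sigmaInv_iff hne).2 ?_⟩
      exact (monoidTypeFP_normalizer_subgroupOf_iff (hGt K hK) hne).1 (h2 K hK)
    · obtain ⟨t, ht, i, hi⟩ := h3 K hK
      refine ⟨t, t.2, ht, i, mul_singleton_subset_iff.2 fun k hk => ?_⟩
      exact ⟨_, hi ⟨k, hGt K hK hk⟩ hk, rfl⟩
  · rintro ⟨Gt, s, H, hfin, hcomm, hH, h⟩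
    have := Subgroup.Normal.of_commutator_le _ hcomm
    have hGt : ∀ K : Subgroup G, Finite K → K ≤ Gt := fun K hK => (h K hK).1
    have h1 := (normalizersSurject_res_iff (χ := χ) hGt).2 fun K hK => (h K hK).2.1
    refine ⟨Gt, hfin, hcomm, hGt, RealChar.conjugatesFiniteSubgroups_iff.2 h1,
      h1.bredonTypeFP_iff.2 ⟨?_, s, fun i => (H i).subgroupOf Gt, fun i => ?_, ?_⟩⟩
    · rw [forall_finite_subgroupOf hGt]
      intro K hK
      obtain ⟨hne, hS⟩ := (h K hK).2.2.1
      exact (monoidTypeFP_normalizer_subgroupOf_iff (hGt K hK) hne).2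
        ((mk_mem_sigmaInv_iff hne).1 hS)
    · have := (hH i).2
      exact Finite.of_injective _ (Subgroup.subgroupOfEquivOfLe (hH i).1).injective
    · rw [forall_finite_subgroupOf hGt]
      intro K hK
      obtain ⟨m, hm, hmχ, i, hi⟩ := (h K hK).2.2.2
      exact ⟨⟨m, hm⟩, hmχ, i, fun k hk => mul_singleton_subset_iff.1 hi k hk⟩
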